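/- Let $(M,g)$ be a complete Riemannian manifold (smooth, finite-dimensional, without boundary), with Levi-Civita connection $\hat\nabla$. Let $\sigma\colon M\to\mathbb R$ be a smooth function that is bounded from below, and let $\alpha_1,\alpha_2,\alpha_3\in\mathbb R$ satisfy $\alpha_1+\alpha_2+\alpha_3\ge 0$. Let $A$ be the cubic form $$A(X,Y,Z)=\alpha_1\, g(X,Y)\,d\sigma(Z)+\alpha_2\, g(Y,Z)\,d\sigma(X)+\alpha_3\, g(X,Z)\,d\sigma(Y),$$ and let $K$ be the $(1,2)$-tensor field defined by $g(K(X,Y),Z)=A(X,Y,Z)$. Then the connection $\nabla=\hat\nabla+K$, that is $\nabla_XY=\hat\nabla_XY+K(X,Y)$, is complete: every $\nabla$-geodesic $\gamma\colon J\to M$ on an open interval $J\subseteq\mathbb R$ (a smooth curve with $\nabla_{\dot\gamma}\dot\gamma=0$) extends to a $\nabla$-geodesic $\mathbb R\to M$. -/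

import Mathlib

open Bundle FiberBundle VectorField
open scoped Manifold ContDiff

noncomputable section LeviCivita

variable {E : Type*} [NormedAddCommGroup E] [NormedSpace ℝ E]
  {H : Type*} [TopologicalSpace H] (I : ModelWithCorners ℝ E H)
  {M : Type*} [TopologicalSpace M] [ChartedSpace H M]
  [RiemannianBundle (fun (x : M) ↦ TangentSpace I x)]

/-- The right-hand side of the Koszul formula for `g(∇_X Y, Z)` at the point `x`. -/
def koszul (Y X Z : Π x : M, TangentSpace I x) (x : M) : ℝ :=
  (1 / 2 : ℝ) *
    (mvfderiv I (fun y ↦ inner ℝ (Y y) (Z y)) x (X x)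
      + mvfderiv I (fun y ↦ inner ℝ (Z y) (X y)) x (Y x)
      - mvfderiv I (fun y ↦ inner ℝ (X y) (Y y)) x (Z x)
      + inner ℝ (mlieBracket I X Y x) (Z x)
      - inner ℝ (mlieBracket I X Z x) (Y x)
      - inner ℝ (mlieBracket I Y Z x) (X x))

section

variable [FiniteDimensional ℝ E]

/-- The endomorphism `L` of the tangent space with `g(L v, w) = B v w` (Riesz representation). -/
def raiseLast {x : M} (B : TangentSpace I x →L[ℝ] TangentSpace I x →L[ℝ] ℝ) :
    TangentSpace I x →L[ℝ] TangentSpace I x :=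
  haveI : FiniteDimensional ℝ (TangentSpace I x) := inferInstanceAs (FiniteDimensional ℝ E)
  haveI : CompleteSpace (TangentSpace I x) := FiniteDimensional.complete ℝ _
  LinearMap.toContinuousLinearMap
    { toFun := fun v ↦ (InnerProductSpace.toDual ℝ (TangentSpace I x)).symm (B v)
      map_add' := fun v w ↦ by simp
      map_smul' := fun c v ↦ by simp }

theorem inner_raiseLast {x : M} (B : TangentSpace I x →L[ℝ] TangentSpace I x →L[ℝ] ℝ)
    (v w : TangentSpace I x) : inner ℝ (raiseLast I B v) w = B v w := by
  have : FiniteDimensional ℝ (TangentSpace I x) := inferInstanceAs (FiniteDimensional ℝ E)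
  have : CompleteSpace (TangentSpace I x) := FiniteDimensional.complete ℝ _
  simp [raiseLast]

end

variable [IsManifold I ∞ M]
  [IsContMDiffRiemannianBundle I ∞ E (fun (x : M) ↦ TangentSpace I x)]

theorem mdiffAt_inner {X Y : Π x : M, TangentSpace I x} {x : M}
    (hX : MDiffAt (T% X) x) (hY : MDiffAt (T% Y) x) :
    MDiffAt (fun y ↦ inner ℝ (X y) (Y y)) x :=
  MDifferentiableAt.inner_bundle (F := E) (E := fun x : M ↦ TangentSpace I x) (b := id)
    (v := X) (w := Y) hX hY

variable [FiniteDimensional ℝ E]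

theorem koszul_add_left {Y Y' X Z : Π x : M, TangentSpace I x} {x : M}
    (hY : MDiffAt (T% Y) x) (hY' : MDiffAt (T% Y') x) (hX : MDiffAt (T% X) x)
    (hZ : MDiffAt (T% Z) x) :
    koszul I (Y + Y') X Z x = koszul I Y X Z x + koszul I Y' X Z x := by
  have : CompleteSpace E := FiniteDimensional.complete ℝ E
  simp only [koszul, Pi.add_apply, inner_add_left, inner_add_right]
  rw [mvfderiv_fun_add (mdiffAt_inner I hY hZ) (mdiffAt_inner I hY' hZ),
    mvfderiv_fun_add (mdiffAt_inner I hX hY) (mdiffAt_inner I hX hY'),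
    mlieBracket_add_right hY hY', mlieBracket_add_left hY hY']
  simp [inner_add_left]
  ring

theorem koszul_smul_left {f : M → ℝ} {Y X Z : Π x : M, TangentSpace I x} {x : M}
    (hf : MDiffAt f x)
    (hY : MDiffAt (T% Y) x) (hX : MDiffAt (T% X) x) (hZ : MDiffAt (T% Z) x) :
    koszul I (f • Y) X Z x = f x * koszul I Y X Z x
      + mvfderiv I f x (X x) * inner ℝ (Y x) (Z x) := by
  have : CompleteSpace E := FiniteDimensional.complete ℝ E
  simp only [koszul, Pi.smul_apply', real_inner_smul_left, real_inner_smul_right]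
  rw [mvfderiv_fun_mul hf (mdiffAt_inner I hY hZ),
    mvfderiv_fun_mul hf (mdiffAt_inner I hX hY),
    mlieBracket_smul_right hf hY, mlieBracket_smul_left hf hY]
  simp [inner_add_left, real_inner_smul_left]
  rw [real_inner_comm (Y x) (X x)]
  ring

theorem tensorialAt_koszul_middle {Y Z : Π x : M, TangentSpace I x} {x : M}
    (hY : MDiffAt (T% Y) x) (hZ : MDiffAt (T% Z) x) :
    TensorialAt I E (fun X : Π x : M, TangentSpace I x ↦ koszul I Y X Z x) x where
  smul {f X} hf hX := by
    have : CompleteSpace E := FiniteDimensional.complete ℝ E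
    simp only [koszul, Pi.smul_apply', real_inner_smul_left, real_inner_smul_right]
    rw [mvfderiv_fun_mul hf (mdiffAt_inner I hZ hX),
      mvfderiv_fun_mul hf (mdiffAt_inner I hX hY),
      mlieBracket_smul_left hf hX, mlieBracket_smul_left hf hX]
    simp [inner_add_left, real_inner_smul_left]
    rw [real_inner_comm (X x) (Z x)]
    ring
  add {X X'} hX hX' := by
    have : CompleteSpace E := FiniteDimensional.complete ℝ E
    simp only [koszul, Pi.add_apply, inner_add_left, inner_add_right]
    rw [mvfderiv_fun_add (mdiffAt_inner I hZ hX) (mdiffAt_inner I hZ hX'),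
      mvfderiv_fun_add (mdiffAt_inner I hX hY) (mdiffAt_inner I hX' hY),
      mlieBracket_add_left hX hX', mlieBracket_add_left hX hX']
    simp [inner_add_left]
    ring

theorem tensorialAt_koszul_right {Y X : Π x : M, TangentSpace I x} {x : M}
    (hY : MDiffAt (T% Y) x) (hX : MDiffAt (T% X) x) :
    TensorialAt I E (fun Z : Π x : M, TangentSpace I x ↦ koszul I Y X Z x) x where
  smul {f Z} hf hZ := by
    have : CompleteSpace E := FiniteDimensional.complete ℝ E
    simp only [koszul, Pi.smul_apply', real_inner_smul_left, real_inner_smul_right]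
    rw [mvfderiv_fun_mul hf (mdiffAt_inner I hY hZ),
      mvfderiv_fun_mul hf (mdiffAt_inner I hZ hX),
      mlieBracket_smul_right hf hZ, mlieBracket_smul_right hf hZ]
    simp [inner_add_left, real_inner_smul_left]
    rw [real_inner_comm (Y x) (Z x)]
    ring
  add {Z Z'} hZ hZ' := by
    have : CompleteSpace E := FiniteDimensional.complete ℝ E
    simp only [koszul, Pi.add_apply, inner_add_left, inner_add_right]
    rw [mvfderiv_fun_add (mdiffAt_inner I hY hZ) (mdiffAt_inner I hY hZ'),
      mvfderiv_fun_add (mdiffAt_inner I hZ hX) (mdiffAt_inner I hZ' hX),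
      mlieBracket_add_right hZ hZ', mlieBracket_add_right hZ hZ']
    simp [inner_add_left]
    ring

/-- The bilinear form `(X, Z) ↦ g(∇_X Y, Z)` at `x`. -/
def koszulForm (Y : Π x : M, TangentSpace I x) (x : M) (hY : MDiffAt (T% Y) x) :
    TangentSpace I x →L[ℝ] TangentSpace I x →L[ℝ] ℝ :=
  TensorialAt.mkHom₂ (fun X Z ↦ koszul I Y X Z x) x
    (fun _ hZ ↦ tensorialAt_koszul_middle I hY hZ) (fun _ hX ↦ tensorialAt_koszul_right I hY hX)

theorem koszulForm_apply {Y X Z : Π x : M, TangentSpace I x} {x : M} (hY : MDiffAt (T% Y) x)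
    (hX : MDiffAt (T% X) x) (hZ : MDiffAt (T% Z) x) :
    koszulForm I Y x hY (X x) (Z x) = koszul I Y X Z x :=
  TensorialAt.mkHom₂_apply (fun _ hZ ↦ tensorialAt_koszul_middle I hY hZ)
    (fun _ hX ↦ tensorialAt_koszul_right I hY hX) hX hZ

variable (M) in
open scoped Classical in
/-- The Levi-Civita connection of the Riemannian metric, given by the Koszul formula.
As for every `CovariantDerivative`, `leviCivita I M Y x (X x)` is `∇_X Y` at `x`; the value on
fields `Y` that are not differentiable at `x` is irrelevant and set to `0`. -/
def leviCivita : CovariantDerivative I E (fun x : M ↦ TangentSpace I x) where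
  toFun Y x := if hY : MDiffAt (T% Y) x then raiseLast I (koszulForm I Y x hY) else 0
  isCovariantDerivativeOnUniv :=
    { add := by
        intro Y Y' x hY hY' _
        have hYY' : MDiffAt (T% (Y + Y')) x := mdifferentiableAt_add_section hY hY'
        rw [dif_pos hY, dif_pos hY', dif_pos hYY']
        ext v
        refine ext_inner_right ℝ fun w ↦ ?_
        have hX := mdifferentiableAt_extend I E v
        have hZ := mdifferentiableAt_extend I E w
        have hv : extend E v x = v := extend_apply_self E v
        have hw : extend E w x = w := extend_apply_self E w
        rw [add_apply, inner_add_left, inner_raiseLast, inner_raiseLast,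
          inner_raiseLast, ← hv, ← hw, koszulForm_apply I _ hX hZ, koszulForm_apply I _ hX hZ,
          koszulForm_apply I _ hX hZ, koszul_add_left I hY hY' hX hZ]
      leibniz := by
        intro Y f x hY hf _
        have hfY : MDiffAt (T% (f • Y)) x := hf.smul_section hY
        rw [dif_pos hY, dif_pos hfY]
        ext v
        refine ext_inner_right ℝ fun w ↦ ?_
        have hX := mdifferentiableAt_extend I E v
        have hZ := mdifferentiableAt_extend I E w
        have hv : extend E v x = v := extend_apply_self E v
        have hw : extend E w x = w := extend_apply_self E w
        rw [add_apply, inner_add_left, smul_apply,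
          ContinuousLinearMap.smulRight_apply, real_inner_smul_left, real_inner_smul_left,
          inner_raiseLast, inner_raiseLast, ← hv, ← hw, koszulForm_apply I _ hX hZ,
          koszulForm_apply I _ hX hZ, koszul_smul_left I hf hY hX hZ] }

open scoped Classical in
theorem inner_leviCivita {Y X Z : Π x : M, TangentSpace I x} {x : M} (hY : MDiffAt (T% Y) x)
    (hX : MDiffAt (T% X) x) (hZ : MDiffAt (T% Z) x) :
    inner ℝ (leviCivita I M Y x (X x)) (Z x) = koszul I Y X Z x := by
  change inner ℝ ((if hY : MDiffAt (T% Y) x then raiseLast I (koszulForm I Y x hY) else 0) (X x))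
    (Z x) = _
  rw [dif_pos hY, inner_raiseLast, koszulForm_apply I hY hX hZ]

/-- The Levi-Civita connection is torsion-free. -/
theorem leviCivita_torsion [CompleteSpace E] : (leviCivita I M).torsion = 0 := by
  rw [CovariantDerivative.torsion_eq_zero_iff]
  intro X Y x hX hY
  refine ext_inner_right ℝ fun w ↦ ?_
  have hZ := mdifferentiableAt_extend I E w
  have hw : extend E w x = w := extend_apply_self E w
  rw [inner_sub_left, ← hw, inner_leviCivita I hY hX hZ, inner_leviCivita I hX hY hZ]
  simp only [koszul]
  rw [mlieBracket_swap_apply (V := Y) (W := X)]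
  simp only [real_inner_comm, inner_neg_left]
  ring

/-- The Levi-Civita connection is metric: `Z g(X, Y) = g(∇_Z X, Y) + g(X, ∇_Z Y)`. -/
theorem leviCivita_metric {X Y Z : Π x : M, TangentSpace I x} {x : M}
    (hZ : MDiffAt (T% Z) x) (hX : MDiffAt (T% X) x) (hY : MDiffAt (T% Y) x) :
    mvfderiv I (fun y ↦ inner ℝ (X y) (Y y)) x (Z x) =
      inner ℝ (leviCivita I M X x (Z x)) (Y x) + inner ℝ (X x) (leviCivita I M Y x (Z x)) := by
  rw [real_inner_comm _ (X x), inner_leviCivita I hX hZ hY, inner_leviCivita I hY hZ hX]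
  simp only [koszul]
  rw [mlieBracket_swap_apply (V := Y) (W := X)]
  simp only [real_inner_comm, inner_neg_left]
  ring

end LeviCivita

noncomputable section Geodesics

variable {E : Type*} [NormedAddCommGroup E] [NormedSpace ℝ E]
  {H : Type*} [TopologicalSpace H] {I : ModelWithCorners ℝ E H}
  {M : Type*} [TopologicalSpace M] [ChartedSpace H M]

variable (I) in
/-- The velocity vector of a curve in `M` at time `t`. -/
def curveVelocity (γ : ℝ → M) (t : ℝ) : TangentSpace I (γ t) :=
  mfderiv 𝓘(ℝ, ℝ) I γ t (1 : ℝ)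

variable [IsManifold I 1 M]

/-- The covariant derivative at time `t` of a vector field `V` along the curve `γ`.
In the local frame `e` of the tangent bundle given by the preferred trivialization at `γ t`, write
`V s = ∑ i, v i s • e i (γ s)`; then
`D V / dt = ∑ i, (deriv (v i) t • e i (γ t) + v i t • ∇_{γ'(t)} (e i))`.
Here `∑ i, v i t • e i` is the section `FiberBundle.extend E (V t)`, which has constant
coefficients in the frame. -/
def covDerivAlong (cov : CovariantDerivative I E (fun x : M ↦ TangentSpace I x))
    (γ : ℝ → M) (V : Π t : ℝ, TangentSpace I (γ t)) (t : ℝ) : TangentSpace I (γ t) :=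
  (trivializationAt E (fun x : M ↦ TangentSpace I x) (γ t)).symm (γ t)
      (deriv (fun s ↦ (trivializationAt E (fun x : M ↦ TangentSpace I x) (γ t) ⟨γ s, V s⟩).2) t)
    + cov (FiberBundle.extend E (V t)) (γ t) (curveVelocity I γ t)

/-- `γ` restricted to the open set `J` of times is a smooth curve with `∇_{γ'} γ' = 0`, i.e. a
geodesic with affine parameter. Values of `γ` outside `J` are irrelevant. -/
structure IsGeodesicOn (cov : CovariantDerivative I E (fun x : M ↦ TangentSpace I x))
    (γ : ℝ → M) (J : Set ℝ) : Prop where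
  contMDiffOn : ContMDiffOn 𝓘(ℝ, ℝ) I ∞ γ J
  covDerivAlong_eq_zero : ∀ t ∈ J, covDerivAlong cov γ (curveVelocity I γ) t = 0

/-- A connection is complete if every geodesic, defined on some open interval, extends to a
geodesic whose affine parameter runs through all of `ℝ`. -/
def IsCompleteConnection (cov : CovariantDerivative I E (fun x : M ↦ TangentSpace I x)) : Prop :=
  ∀ (J : Set ℝ) (γ : ℝ → M), IsOpen J → J.OrdConnected → J.Nonempty → IsGeodesicOn cov γ J →
    ∃ γ' : ℝ → M, IsGeodesicOn cov γ' Set.univ ∧ Set.EqOn γ' γ J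

end Geodesics

noncomputable section DifferenceTensor

variable {E : Type*} [NormedAddCommGroup E] [NormedSpace ℝ E]
  {H : Type*} [TopologicalSpace H] (I : ModelWithCorners ℝ E H)
  {M : Type*} [TopologicalSpace M] [ChartedSpace H M]
  [RiemannianBundle (fun (x : M) ↦ TangentSpace I x)]

/-- The cubic form
`A(X, Y, Z) = α₁ g(X, Y) dσ(Z) + α₂ g(Y, Z) dσ(X) + α₃ g(X, Z) dσ(Y)` at the point `x`. -/
def cubicForm (σ : M → ℝ) (α₁ α₂ α₃ : ℝ) (x : M) (X Y Z : TangentSpace I x) : ℝ :=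
  α₁ * inner ℝ X Y * mvfderiv I σ x Z + α₂ * inner ℝ Y Z * mvfderiv I σ x X
    + α₃ * inner ℝ X Z * mvfderiv I σ x Y

variable {I} [IsManifold I 1 M]

/-- The connection `∇ + K`, with `(∇ + K)_X Y = ∇_X Y + K(X, Y)`. -/
def addDifferenceTensor (cov : CovariantDerivative I E (fun x : M ↦ TangentSpace I x))
    (K : Π x : M, TangentSpace I x →L[ℝ] TangentSpace I x →L[ℝ] TangentSpace I x) :
    CovariantDerivative I E (fun x : M ↦ TangentSpace I x) :=
  cov.addOneForm (fun x ↦ (K x).flip)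

theorem addDifferenceTensor_apply
    (cov : CovariantDerivative I E (fun x : M ↦ TangentSpace I x))
    (K : Π x : M, TangentSpace I x →L[ℝ] TangentSpace I x →L[ℝ] TangentSpace I x)
    (X Y : Π x : M, TangentSpace I x) (x : M) :
    addDifferenceTensor cov K Y x (X x) = cov Y x (X x) + K x (X x) (Y x) :=
  rfl

end DifferenceTensor

/-! Let γ be a ∇-geodesic and α = α₁ + α₂ + α₃. The Levi-Civita acceleration of γ is -K(γ', γ'), and
A(γ', γ', γ') = α |γ'|² dσ(γ'), so metric compatibility gives (|γ'|²)' = -2α |γ'|² (σ ∘ γ)'. Hence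
|γ'|² e^{2ασ} is constant along γ. Since α ≥ 0 and σ is bounded below, the speed is bounded
(`exists_norm_curveVelocity_le`). Only the diagonal values K(X, X) matter for geodesics, so the
torsion of ∇ plays no role.

The rest is the argument by which metric completeness implies geodesic completeness, valid for every
smooth connection whose geodesics have bounded speed. A curve of bounded speed is Lipschitz for the
Riemannian distance, so it converges in M at a finite end of its interval. In a chart at the limit
point the geodesic equation is a smooth first order system for position and velocity. Both stay in a
compact set, so the right-hand side is bounded, the velocity converges as well
(`exists_tendsto_chart`), and Picard–Lindelöf continues the solution (`exists_extension_sSup`).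
Zorn's lemma gives a maximal geodesic, whose domain must be ℝ.

To get into the chart, the connection is expressed through Christoffel symbols
(`covDerivAlong_curveVelocity_eq_zero_iff`). They are smooth by the Koszul formula and the
invertibility of the Gram matrix (`isSmoothConnection_addDifferenceTensor`). -/

open Filter Topology Set

/-! ### Coordinate frames and connections in a chart -/

section CoordinateFrames

variable {E : Type*} [NormedAddCommGroup E] [NormedSpace ℝ E]
  {M : Type*} [TopologicalSpace M] [ChartedSpace E M] [IsManifold 𝓘(ℝ, E) ∞ M]

/-- The vector field on the chart domain at `p` with constant coordinates `a`. -/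
noncomputable def coordField (p : M) (a : E) (y : M) : TangentSpace 𝓘(ℝ, E) y :=
  (trivializationAt E (fun x : M ↦ TangentSpace 𝓘(ℝ, E) x) p).symm y a

/-- The coordinates of a tangent vector at `y` with respect to the chart at `p`. -/
noncomputable def tangentCoord (p y : M) (v : TangentSpace 𝓘(ℝ, E) y) : E :=
  (trivializationAt E (fun x : M ↦ TangentSpace 𝓘(ℝ, E) x) p ⟨y, v⟩).2

theorem coordField_eq_symmL {p y : M} (hy : y ∈ (chartAt E p).source) (a : E) :
    coordField p a y =
      (trivializationAt E (fun x : M ↦ TangentSpace 𝓘(ℝ, E) x) p).symmL ℝ y a :=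
  (Trivialization.symmL_apply (R := ℝ) _ (by simpa using hy) a).symm

theorem tangentCoord_eq_continuousLinearMapAt {p y : M} (hy : y ∈ (chartAt E p).source)
    (v : TangentSpace 𝓘(ℝ, E) y) : tangentCoord p y v =
      (trivializationAt E (fun x : M ↦ TangentSpace 𝓘(ℝ, E) x) p).continuousLinearMapAt ℝ y v := by
  rw [Trivialization.continuousLinearMapAt_apply, Trivialization.coe_linearMapAt_of_mem]
  · rfl
  · simpa using hy

theorem tangentCoord_eq_mfderiv {p y : M} (hy : y ∈ (chartAt E p).source)
    (v : TangentSpace 𝓘(ℝ, E) y) :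
    tangentCoord p y v = mfderiv 𝓘(ℝ, E) 𝓘(ℝ, E) (extChartAt 𝓘(ℝ, E) p) y v := by
  rw [tangentCoord_eq_continuousLinearMapAt hy,
    TangentBundle.continuousLinearMapAt_trivializationAt hy]
  rfl

theorem tangentCoord_coordField {p y : M} (hy : y ∈ (chartAt E p).source) (a : E) :
    tangentCoord p y (coordField p a y) = a := by
  have hy' : y ∈ (trivializationAt E (fun x : M ↦ TangentSpace 𝓘(ℝ, E) x) p).baseSet := by
    simpa using hy
  simp only [tangentCoord, coordField]
  rw [Trivialization.apply_mk_symm _ hy']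

theorem coordField_tangentCoord {p y : M} (hy : y ∈ (chartAt E p).source)
    (v : TangentSpace 𝓘(ℝ, E) y) : coordField p (tangentCoord p y v) y = v := by
  have hy' : y ∈ (trivializationAt E (fun x : M ↦ TangentSpace 𝓘(ℝ, E) x) p).baseSet := by
    simpa using hy
  simp only [tangentCoord, coordField]
  exact Trivialization.symm_apply_apply_mk _ hy' v

theorem tangentCoord_add {p y : M} (hy : y ∈ (chartAt E p).source)
    (v w : TangentSpace 𝓘(ℝ, E) y) :
    tangentCoord p y (v + w) = tangentCoord p y v + tangentCoord p y w := by
  simp [tangentCoord_eq_continuousLinearMapAt hy]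

theorem coordField_add {p y : M} (hy : y ∈ (chartAt E p).source) (a b : E) :
    coordField p (a + b) y = coordField p a y + coordField p b y := by
  simp [coordField_eq_symmL hy]

theorem coordField_sum_smul {ι : Type*} (s : Finset ι) {p y : M} (hy : y ∈ (chartAt E p).source)
    (c : ι → ℝ) (a : ι → E) :
    coordField p (∑ i ∈ s, c i • a i) y = ∑ i ∈ s, c i • coordField p (a i) y := by
  simp [coordField_eq_symmL hy, map_sum]

/-- A vector field is smooth at a point of a chart domain iff its coordinates are. -/
theorem contMDiffAt_iff_tangentCoord {n : ℕ∞} {p x : M} (hx : x ∈ (chartAt E p).source)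
    {W : Π y : M, TangentSpace 𝓘(ℝ, E) y} :
    ContMDiffAt 𝓘(ℝ, E) 𝓘(ℝ, E).tangent n (T% W) x ↔
      ContMDiffAt 𝓘(ℝ, E) 𝓘(ℝ, E) n (fun y ↦ tangentCoord p y (W y)) x := by
  -- The tangent bundle has one degree of smoothness less than the manifold.
  have : IsManifold 𝓘(ℝ, E) (n + 1) M := IsManifold.of_le (n := ∞) (by
    exact_mod_cast le_top)
  have : ContMDiffVectorBundle n E (fun x : M ↦ TangentSpace 𝓘(ℝ, E) x) 𝓘(ℝ, E) :=
    TangentBundle.contMDiffVectorBundle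
  have hx' : x ∈ (trivializationAt E (fun x : M ↦ TangentSpace 𝓘(ℝ, E) x) p).baseSet := by
    simpa using hx
  rw [← contMDiffWithinAt_univ, ← contMDiffWithinAt_univ]
  exact Trivialization.contMDiffWithinAt_section (IB := 𝓘(ℝ, E)) univ hx'

theorem contMDiffAt_coordField {p x : M} (hx : x ∈ (chartAt E p).source) (a : E) {n : ℕ∞} :
    ContMDiffAt 𝓘(ℝ, E) 𝓘(ℝ, E).tangent n (T% (coordField p a)) x := by
  rw [contMDiffAt_iff_tangentCoord hx]
  refine (contMDiffAt_const (c := a)).congr_of_eventuallyEq ?_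
  filter_upwards [(chartAt E p).open_source.mem_nhds hx] with y hy
  exact tangentCoord_coordField hy a

theorem mdifferentiableAt_coordField {p x : M} (hx : x ∈ (chartAt E p).source) (a : E) :
    MDiffAt (T% (coordField p a)) x :=
  (contMDiffAt_coordField (n := 1) hx a).mdifferentiableAt one_ne_zero

variable (cov : CovariantDerivative 𝓘(ℝ, E) E (fun x : M ↦ TangentSpace 𝓘(ℝ, E) x))

/-- Iterated Leibniz rule. It reduces a connection over a chart to its values on finitely many
coordinate fields. -/
theorem cov_sum_smul {ι : Type*} (s : Finset ι) {g : ι → M → ℝ}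
    {S : ι → Π y : M, TangentSpace 𝓘(ℝ, E) y} {x : M}
    (hg : ∀ i ∈ s, MDiffAt (g i) x) (hS : ∀ i ∈ s, MDiffAt (T% (S i)) x)
    (X : TangentSpace 𝓘(ℝ, E) x) :
    cov (fun y ↦ ∑ i ∈ s, g i y • S i y) x X =
      ∑ i ∈ s, (g i x • cov (S i) x X + mvfderiv 𝓘(ℝ, E) (g i) x X • S i x) := by
  classical
  induction s using Finset.induction_on with
  | empty =>
    have : (fun y : M ↦ ∑ i ∈ (∅ : Finset ι), g i y • S i y) = 0 := by ext; simp
    rw [this, cov.zero]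
    simp
  | insert j s hj ih =>
    have h1 : (fun y : M ↦ ∑ i ∈ insert j s, g i y • S i y) =
        (g j • S j) + fun y ↦ ∑ i ∈ s, g i y • S i y := by
      ext y; simp [Finset.sum_insert hj]
    have hgj := hg j (Finset.mem_insert_self _ _)
    have hSj := hS j (Finset.mem_insert_self _ _)
    have hg' : ∀ i ∈ s, MDiffAt (g i) x := fun i hi ↦ hg i (Finset.mem_insert_of_mem hi)
    have hS' : ∀ i ∈ s, MDiffAt (T% (S i)) x := fun i hi ↦ hS i (Finset.mem_insert_of_mem hi)
    have hm : MDiffAt (T% (fun y ↦ ∑ i ∈ s, g i y • S i y)) x :=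
      MDifferentiableAt.sum_section fun i hi ↦ (hg' i hi).smul_section (hS' i hi)
    rw [h1, cov.isCovariantDerivativeOnUniv.add (hgj.smul_section hSj) hm,
      cov.isCovariantDerivativeOnUniv.leibniz hSj hgj, Finset.sum_insert hj, ← ih hg' hS']
    simp

variable [FiniteDimensional ℝ E]

/-- Expansion of the covariant derivative of a vector field in a coordinate frame. -/
theorem cov_coordField_eq_sum {q x : M} (hx : x ∈ (chartAt E q).source) {W : M → E}
    (hW : MDiffAt W x) :
    cov (fun y ↦ coordField q (W y) y) x = cov (fun y ↦ ∑ i,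
      (Module.finBasis ℝ E).coord i (W y) • coordField q (Module.finBasis ℝ E i) y) x := by
  -- The frame expansion is needed only near `x`, because a connection depends only on the germ of
  -- the field.
  have hev : ∀ᶠ y in 𝓝 x, coordField q (W y) y = ∑ i,
      (Module.finBasis ℝ E).coord i (W y) • coordField q (Module.finBasis ℝ E i) y := by
    filter_upwards [(chartAt E q).open_source.mem_nhds hx] with y hy
    conv_lhs => rw [← (Module.finBasis ℝ E).sum_repr (W y)]
    exact coordField_sum_smul _ hy _ _
  have hm : MDiffAt (T% (fun y ↦ ∑ i,
      (Module.finBasis ℝ E).coord i (W y) • coordField q (Module.finBasis ℝ E i) y)) x :=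
    MDifferentiableAt.sum_section fun i _ ↦
      ((((Module.finBasis ℝ E).coord i).toContinuousLinearMap.differentiableAt.mdifferentiableAt).comp
        x hW).smul_section (mdifferentiableAt_coordField hx _)
  refine cov.isCovariantDerivativeOnUniv.congr_of_eventuallyEq ?_ hm univ_mem hev
  refine hm.congr_of_eventuallyEq ?_
  filter_upwards [hev] with y hy
  rw [hy]

/-- The coefficients are constant, so the derivative terms of the Leibniz rule vanish. This
linearity in `a` is what makes the Christoffel form a quadratic polynomial. -/
theorem cov_coordField_const {q x : M} (hx : x ∈ (chartAt E q).source) (a : E)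
    (X : TangentSpace 𝓘(ℝ, E) x) :
    cov (coordField q a) x X = ∑ i, (Module.finBasis ℝ E).coord i a •
      cov (coordField q (Module.finBasis ℝ E i)) x X := by
  have := cov_coordField_eq_sum cov hx (W := fun _ ↦ a) mdifferentiableAt_const
  change cov (coordField q a) x = _ at this
  rw [this, cov_sum_smul cov _ (fun i _ ↦ mdifferentiableAt_const)
      (fun i _ ↦ mdifferentiableAt_coordField hx _)]
  simp only [mvfderiv_const, zero_apply, zero_smul, add_zero]

/-- The covariant derivative of a vector field given by its coordinates. -/
theorem cov_coordField_of_coord {q x : M} (hx : x ∈ (chartAt E q).source) {W : M → E}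
    (hW : MDiffAt W x) (X : TangentSpace 𝓘(ℝ, E) x) :
    cov (fun y ↦ coordField q (W y) y) x X =
      coordField q (mvfderiv 𝓘(ℝ, E) W x X) x + cov (coordField q (W x)) x X := by
  let b := Module.finBasis ℝ E
  let g : Fin (Module.finrank ℝ E) → M → ℝ := fun i y ↦ (b.coord i).toContinuousLinearMap (W y)
  have hg : ∀ i, MDiffAt (g i) x := fun i ↦
    ((b.coord i).toContinuousLinearMap.differentiableAt.mdifferentiableAt).comp x hW
  have hdg : ∀ i, mvfderiv 𝓘(ℝ, E) (g i) x X = b.coord i (mvfderiv 𝓘(ℝ, E) W x X) := fun i ↦ by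
    have := mfderiv_comp (I' := 𝓘(ℝ, E)) (I'' := 𝓘(ℝ, ℝ)) x
      (g := (b.coord i).toContinuousLinearMap)
      ((b.coord i).toContinuousLinearMap.differentiableAt.mdifferentiableAt) hW
    have h2 := congrArg (fun L ↦ L X) this
    rw [mfderiv_eq_fderiv, ContinuousLinearMap.fderiv] at h2
    exact h2
  have h1 := cov_sum_smul cov Finset.univ (g := g) (S := fun i ↦ coordField q (b i))
    (fun i _ ↦ hg i) (fun i _ ↦ mdifferentiableAt_coordField hx _) X
  rw [cov_coordField_eq_sum cov hx hW, cov_coordField_const cov hx]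
  conv_rhs => rw [← b.sum_repr (mvfderiv 𝓘(ℝ, E) W x X), coordField_sum_smul _ hx]
  refine h1.trans ?_
  rw [Finset.sum_add_distrib, add_comm]
  congr 1
  refine Finset.sum_congr rfl fun i _ ↦ ?_
  rw [hdg]
  rfl

end CoordinateFrames

/-! ### Covariant derivatives along curves and the geodesic equation in a chart -/

section AlongCurves

variable {E : Type*} [NormedAddCommGroup E] [NormedSpace ℝ E]
  {M : Type*} [TopologicalSpace M] [ChartedSpace E M] [IsManifold 𝓘(ℝ, E) ∞ M]

/-- The transition map of the tangent bundle between the charts at `p` and at `q`. -/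
noncomputable def tangentTransition (p q y : M) : E →L[ℝ] E :=
  (trivializationAt E (fun x : M ↦ TangentSpace 𝓘(ℝ, E) x) p).coordChangeL ℝ
    (trivializationAt E (fun x : M ↦ TangentSpace 𝓘(ℝ, E) x) q) y

theorem tangentTransition_apply {p q y : M} (hp : y ∈ (chartAt E p).source)
    (hq : y ∈ (chartAt E q).source) (c : E) :
    tangentTransition p q y c = tangentCoord q y (coordField p c y) :=
  Trivialization.coordChangeL_apply (R := ℝ) _ _ ⟨by simpa using hp, by simpa using hq⟩ c

theorem mdifferentiableAt_tangentTransition {p q y : M} (hp : y ∈ (chartAt E p).source)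
    (hq : y ∈ (chartAt E q).source) :
    MDifferentiableAt 𝓘(ℝ, E) 𝓘(ℝ, E →L[ℝ] E)
      (tangentTransition (E := E) p q) y := by
  have h := contMDiffOn_coordChangeL (n := 1) (𝕜 := ℝ) (IB := 𝓘(ℝ, E))
    (trivializationAt E (fun x : M ↦ TangentSpace 𝓘(ℝ, E) x) p)
    (trivializationAt E (fun x : M ↦ TangentSpace 𝓘(ℝ, E) x) q)
  refine (h.contMDiffAt ?_).mdifferentiableAt one_ne_zero
  refine IsOpen.mem_nhds ?_ ⟨by simpa using hp, by simpa using hq⟩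
  exact (Trivialization.open_baseSet _).inter (Trivialization.open_baseSet _)

theorem coordField_tangentTransition {p q y : M} (hp : y ∈ (chartAt E p).source)
    (hq : y ∈ (chartAt E q).source) (c : E) :
    coordField q (tangentTransition p q y c) y = coordField p c y := by
  rw [tangentTransition_apply hp hq, coordField_tangentCoord hq]

theorem tangentTransition_tangentCoord {p q y : M} (hp : y ∈ (chartAt E p).source)
    (hq : y ∈ (chartAt E q).source) (v : TangentSpace 𝓘(ℝ, E) y) :
    tangentTransition p q y (tangentCoord p y v) = tangentCoord q y v := by
  rw [tangentTransition_apply hp hq, coordField_tangentCoord hp]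

omit [IsManifold 𝓘(ℝ, E) ∞ M] in
/-- Chain rule for a function along a curve. -/
theorem hasDerivAt_comp_curve {F : Type*} [NormedAddCommGroup F] [NormedSpace ℝ F] {γ : ℝ → M}
    {t : ℝ} (hγ : MDiffAt γ t) {f : M → F} (hf : MDiffAt f (γ t)) :
    HasDerivAt (fun s ↦ f (γ s)) (mvfderiv 𝓘(ℝ, E) f (γ t) (curveVelocity 𝓘(ℝ, E) γ t)) t := by
  let L : ℝ →L[ℝ] F := mfderiv 𝓘(ℝ, ℝ) 𝓘(ℝ, F) (fun s ↦ f (γ s)) t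
  have h : HasFDerivAt (fun s ↦ f (γ s)) L t := (hf.comp t hγ).hasMFDerivAt.hasFDerivAt
  have h2 := mfderiv_comp t hf hγ
  have h3 : mvfderiv 𝓘(ℝ, E) f (γ t) (curveVelocity 𝓘(ℝ, E) γ t) = L 1 :=
    (congrArg (fun L ↦ L (1 : ℝ)) h2).symm
  rw [h3]
  exact h.hasDerivAt

omit [IsManifold 𝓘(ℝ, E) ∞ M] in
theorem mvfderiv_clm_apply {F G : Type*} [NormedAddCommGroup F] [NormedSpace ℝ F]
    [NormedAddCommGroup G] [NormedSpace ℝ G] {T : M → F →L[ℝ] G} {y : M} (hT : MDiffAt T y)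
    (c : F) (X : TangentSpace 𝓘(ℝ, E) y) :
    mvfderiv 𝓘(ℝ, E) (fun z ↦ T z c) y X = mvfderiv 𝓘(ℝ, E) T y X c := by
  have h := ((ContinuousLinearMap.apply ℝ G c).hasFDerivAt
    (x := T y)).hasMFDerivAt.comp y hT.hasMFDerivAt
  have := h.mfderiv
  exact congrArg (fun L ↦ L X) this

omit [IsManifold 𝓘(ℝ, E) ∞ M] in
theorem mdifferentiableAt_clm_apply {F G : Type*} [NormedAddCommGroup F] [NormedSpace ℝ F]
    [NormedAddCommGroup G] [NormedSpace ℝ G] {T : M → F →L[ℝ] G} {y : M}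
    (hT : MDiffAt T y) (c : F) :
    MDiffAt (fun z ↦ T z c) y :=
  ((ContinuousLinearMap.apply ℝ G c).differentiableAt.mdifferentiableAt).comp y hT

theorem tangentCoord_curveVelocity {p : M} {γ : ℝ → M} {t : ℝ}
    (hγ : MDiffAt γ t) (hp : γ t ∈ (chartAt E p).source) :
    tangentCoord p (γ t) (curveVelocity 𝓘(ℝ, E) γ t) =
      deriv (fun s ↦ extChartAt 𝓘(ℝ, E) p (γ s)) t := by
  rw [(hasDerivAt_comp_curve hγ (mdifferentiableAt_extChartAt (by simpa using hp))).deriv,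
    tangentCoord_eq_mfderiv hp]
  rfl

theorem tangentCoord_curveVelocity_eventuallyEq {p : M} {γ : ℝ → M} {t : ℝ}
    (hγ : ContMDiffAt 𝓘(ℝ, ℝ) 𝓘(ℝ, E) ∞ γ t) (hp : γ t ∈ (chartAt E p).source) :
    (fun s ↦ tangentCoord p (γ s) (curveVelocity 𝓘(ℝ, E) γ s)) =ᶠ[𝓝 t]
      deriv (fun s ↦ extChartAt 𝓘(ℝ, E) p (γ s)) := by
  have h1 : ContMDiffAt 𝓘(ℝ, ℝ) 𝓘(ℝ, E) 1 γ t := hγ.of_le (by exact_mod_cast le_top)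
  filter_upwards [contMDiffAt_iff_contMDiffAt_nhds (by simp) |>.1 h1,
    hγ.continuousAt ((chartAt E p).open_source.mem_nhds hp)] with s h1 h2
  exact tangentCoord_curveVelocity (h1.mdifferentiableAt one_ne_zero) h2

theorem differentiableAt_tangentCoord_curveVelocity {p : M} {γ : ℝ → M} {t : ℝ}
    (hγ : ContMDiffAt 𝓘(ℝ, ℝ) 𝓘(ℝ, E) ∞ γ t) (hp : γ t ∈ (chartAt E p).source) :
    DifferentiableAt ℝ (fun s ↦ tangentCoord p (γ s) (curveVelocity 𝓘(ℝ, E) γ s)) t := by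
  have hx : ContDiffAt ℝ ∞ (fun s ↦ extChartAt 𝓘(ℝ, E) p (γ s)) t :=
    ((contMDiffAt_extChartAt' (by simpa using hp)).comp t hγ).contDiffAt
  have hx' : ContDiffAt ℝ 1 (deriv (fun s ↦ extChartAt 𝓘(ℝ, E) p (γ s))) t :=
    ContDiffAt.derivWithin hx (by norm_cast)
  exact (hx'.differentiableAt one_ne_zero).congr_of_eventuallyEq
    (tangentCoord_curveVelocity_eventuallyEq hγ hp)

variable [FiniteDimensional ℝ E]
  (cov : CovariantDerivative 𝓘(ℝ, E) E (fun x : M ↦ TangentSpace 𝓘(ℝ, E) x))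

/-- The covariant derivative along a curve may be computed in the frame of any chart. -/
theorem covDerivAlong_eq {p : M} {γ : ℝ → M} {t : ℝ} (hγ : MDiffAt γ t)
    (hp : γ t ∈ (chartAt E p).source) {V : Π s : ℝ, TangentSpace 𝓘(ℝ, E) (γ s)}
    (hV : DifferentiableAt ℝ (fun s ↦ tangentCoord p (γ s) (V s)) t) :
    covDerivAlong cov γ V t =
      coordField p (deriv (fun s ↦ tangentCoord p (γ s) (V s)) t) (γ t) +
        cov (coordField p (tangentCoord p (γ t) (V t))) (γ t) (curveVelocity 𝓘(ℝ, E) γ t) := by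
  have hq : γ t ∈ (chartAt E (γ t)).source := mem_chart_source E (γ t)
  have hT := mdifferentiableAt_tangentTransition hp hq
  set c := tangentCoord p (γ t) (V t) with hc
  -- The product rule for the change of frame. Its first term, with the derivative of the transition
  -- map, reappears below when `cov` differentiates the frame at `p` written in the frame at `γ t`;
  -- the two match.
  have hu : deriv (fun s ↦ tangentCoord (γ t) (γ s) (V s)) t =
      mvfderiv 𝓘(ℝ, E) (tangentTransition (E := E) p (γ t)) (γ t) (curveVelocity 𝓘(ℝ, E) γ t) c +
        tangentTransition (E := E) p (γ t) (γ t) (deriv (fun s ↦ tangentCoord p (γ s) (V s)) t) := by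
    have h0 : HasDerivAt (fun s ↦ tangentTransition (E := E) p (γ t) (γ s))
        (mvfderiv 𝓘(ℝ, E) (tangentTransition (E := E) p (γ t)) (γ t) (curveVelocity 𝓘(ℝ, E) γ t)) t :=
      hasDerivAt_comp_curve hγ hT
    have h1 := h0.clm_apply hV.hasDerivAt
    rw [← h1.deriv]
    apply Filter.EventuallyEq.deriv_eq
    filter_upwards [hγ.continuousAt ((chartAt E p).open_source.mem_nhds hp),
      hγ.continuousAt ((chartAt E (γ t)).open_source.mem_nhds hq)] with s h2 h3
    exact (tangentTransition_tangentCoord h2 h3 (V s)).symm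
  have hcov : cov (coordField p c) (γ t) =
      cov (fun y ↦ coordField (γ t) (tangentTransition (E := E) p (γ t) y c) y) (γ t) := by
    have hev : ∀ᶠ y in 𝓝 (γ t), coordField p c y =
        coordField (γ t) (tangentTransition (E := E) p (γ t) y c) y := by
      filter_upwards [(chartAt E p).open_source.mem_nhds hp,
        (chartAt E (γ t)).open_source.mem_nhds hq] with y h2 h3
      exact (coordField_tangentTransition h2 h3 c).symm
    have hm := mdifferentiableAt_coordField hp c
    refine cov.isCovariantDerivativeOnUniv.congr_of_eventuallyEq hm ?_ univ_mem hev
    refine hm.congr_of_eventuallyEq ?_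
    filter_upwards [hev] with y hy
    rw [hy]
  rw [hcov, cov_coordField_of_coord cov hq (mdifferentiableAt_clm_apply hT c),
    mvfderiv_clm_apply hT, tangentTransition_tangentCoord hp hq]
  have hdef : covDerivAlong cov γ V t =
      coordField (γ t) (deriv (fun s ↦ tangentCoord (γ t) (γ s) (V s)) t) (γ t) +
        cov (coordField (γ t) (tangentCoord (γ t) (γ t) (V t))) (γ t)
          (curveVelocity 𝓘(ℝ, E) γ t) := rfl
  rw [hdef, hu, coordField_add hq, coordField_tangentTransition hp hq]
  abel

/-- The quadratic form of Christoffel symbols of a connection in the chart at `p`. -/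
noncomputable def christoffelQuad (p y : M) (a : E) : E :=
  tangentCoord p y (cov (coordField p a) y (coordField p a y))

/-- The geodesic equation in the chart at `p`. -/
theorem covDerivAlong_curveVelocity_eq_zero_iff {p : M} {γ : ℝ → M} {t : ℝ}
    (hγ : ContMDiffAt 𝓘(ℝ, ℝ) 𝓘(ℝ, E) ∞ γ t) (hp : γ t ∈ (chartAt E p).source) :
    covDerivAlong cov γ (curveVelocity 𝓘(ℝ, E) γ) t = 0 ↔
      deriv (deriv (fun s ↦ extChartAt 𝓘(ℝ, E) p (γ s))) t +
        christoffelQuad cov p (γ t) (deriv (fun s ↦ extChartAt 𝓘(ℝ, E) p (γ s)) t) = 0 := by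
  have hd : MDiffAt γ t := hγ.mdifferentiableAt (by simp)
  have hev := tangentCoord_curveVelocity_eventuallyEq hγ hp
  have hev0 := hev.eq_of_nhds
  beta_reduce at hev0
  rw [covDerivAlong_eq cov hd hp (differentiableAt_tangentCoord_curveVelocity hγ hp), hev.deriv_eq,
    hev0, christoffelQuad]
  have hv : coordField p (deriv (fun s ↦ extChartAt 𝓘(ℝ, E) p (γ s)) t) (γ t) =
      curveVelocity 𝓘(ℝ, E) γ t := by
    rw [← tangentCoord_curveVelocity hd hp, coordField_tangentCoord hp]
  rw [hv]
  constructor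
  · intro h
    have := congrArg (tangentCoord p (γ t)) h
    rw [tangentCoord_add hp, tangentCoord_coordField hp] at this
    rw [this, tangentCoord_eq_continuousLinearMapAt hp, map_zero]
  · intro h
    have := congrArg (fun a ↦ coordField p a (γ t)) h
    simp only [coordField_add hp, coordField_tangentCoord hp] at this
    rw [this, coordField_eq_symmL hp, map_zero]

end AlongCurves

/-! ### Smoothness of the metric, brackets and the Koszul expression -/

section Smoothness

variable {E : Type*} [NormedAddCommGroup E] [NormedSpace ℝ E]
  {M : Type*} [TopologicalSpace M] [ChartedSpace E M] [IsManifold 𝓘(ℝ, E) ∞ M]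

/-- The derivative of a smooth function along a smooth vector field is smooth. -/
theorem contMDiffOn_mvfderiv_apply {U : Set M} (hU : IsOpen U) {f : M → ℝ}
    (hf : ContMDiffOn 𝓘(ℝ, E) 𝓘(ℝ, ℝ) ∞ f U) {X : Π y : M, TangentSpace 𝓘(ℝ, E) y}
    (hX : ContMDiffOn 𝓘(ℝ, E) 𝓘(ℝ, E).tangent ∞ (T% X) U) :
    ContMDiffOn 𝓘(ℝ, E) 𝓘(ℝ, ℝ) ∞ (fun y ↦ mvfderiv 𝓘(ℝ, E) f y (X y)) U := by
  -- The derivative is the fibre component of the tangent map of `f` composed with the section `X`.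
  have h1 := hf.contMDiffOn_tangentMapWithin (m := ∞) (by simp) hU.uniqueMDiffOn
  have h2 := h1.comp hX (fun y hy ↦ hy)
  have h3 := (contMDiff_snd_tangentBundle_modelSpace (n := ∞) ℝ 𝓘(ℝ, ℝ)).comp_contMDiffOn h2
  refine h3.congr fun y hy ↦ ?_
  exact congrArg (fun L ↦ L (X y)) (mfderivWithin_of_isOpen (I := 𝓘(ℝ, E)) (I' := 𝓘(ℝ, ℝ))
    (f := f) hU hy).symm

variable [FiniteDimensional ℝ E]

theorem contMDiffAt_mlieBracket {V W : Π y : M, TangentSpace 𝓘(ℝ, E) y} {x : M}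
    (hV : ContMDiffAt 𝓘(ℝ, E) 𝓘(ℝ, E).tangent ∞ (T% V) x)
    (hW : ContMDiffAt 𝓘(ℝ, E) 𝓘(ℝ, E).tangent ∞ (T% W) x) :
    ContMDiffAt 𝓘(ℝ, E) 𝓘(ℝ, E).tangent ∞ (T% (mlieBracket 𝓘(ℝ, E) V W)) x := by
  have : CompleteSpace E := FiniteDimensional.complete ℝ E
  have : IsManifold 𝓘(ℝ, E) (((⊤ : ℕ∞) : ℕ∞ω) + 1) M := by
    simpa using (inferInstance : IsManifold 𝓘(ℝ, E) ∞ M)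
  have : IsManifold 𝓘(ℝ, E) (minSmoothness ℝ 2) M := by
    simpa using (inferInstance : IsManifold 𝓘(ℝ, E) 2 M)
  exact ContMDiffAt.mlieBracket_vectorField (m := ⊤) (n := ⊤) hV hW (by simp)

variable [RiemannianBundle (fun (x : M) ↦ TangentSpace 𝓘(ℝ, E) x)]

/-- The matrix of the Riemannian metric in the chart at `p`, as a bilinear form. -/
noncomputable def gramForm (p y : M) : E →L[ℝ] E →L[ℝ] ℝ :=
  ∑ i, ∑ j, (inner ℝ (coordField p (Module.finBasis ℝ E i) y)
    (coordField p (Module.finBasis ℝ E j) y)) •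
      ((Module.finBasis ℝ E).coord i).toContinuousLinearMap.smulRight
        ((Module.finBasis ℝ E).coord j).toContinuousLinearMap

theorem sum_coord_smul_finBasis (a : E) :
    ∑ i, (Module.finBasis ℝ E).coord i a • Module.finBasis ℝ E i = a :=
  (Module.finBasis ℝ E).sum_repr a

theorem gramForm_apply {p y : M} (hy : y ∈ (chartAt E p).source) (a c : E) :
    gramForm p y a c = inner ℝ (coordField p a y) (coordField p c y) := by
  conv_rhs => rw [← sum_coord_smul_finBasis a, ← sum_coord_smul_finBasis c,
    coordField_sum_smul _ hy, coordField_sum_smul _ hy, sum_inner]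
  simp only [gramForm, sum_apply, inner_sum, real_inner_smul_left,
    real_inner_smul_right, smul_apply, ContinuousLinearMap.smulRight_apply,
    LinearMap.coe_toContinuousLinearMap', smul_eq_mul]
  refine Finset.sum_congr rfl fun i _ ↦ Finset.sum_congr rfl fun j _ ↦ ?_
  ring

/-- The metric in the chart at `p` as an isomorphism onto the dual space. -/
theorem exists_equiv_gramForm {p y : M} (hy : y ∈ (chartAt E p).source) :
    ∃ e : E ≃L[ℝ] (E →L[ℝ] ℝ), (e : E →L[ℝ] (E →L[ℝ] ℝ)) = gramForm p y := by
  -- Positive definiteness gives injectivity; equality of dimensions does the rest.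
  have hinj : Function.Injective (gramForm (E := E) p y).toLinearMap := by
    rw [← LinearMap.ker_eq_bot, LinearMap.ker_eq_bot']
    intro a ha
    have h1 : gramForm p y a a = 0 := by
      have : gramForm p y a = 0 := ha
      rw [this]; rfl
    rw [gramForm_apply hy, inner_self_eq_zero] at h1
    rw [← tangentCoord_coordField hy a, h1, tangentCoord_eq_continuousLinearMapAt hy, map_zero]
  have hdim : Module.finrank ℝ E = Module.finrank ℝ (E →L[ℝ] ℝ) := by
    rw [← (LinearMap.toContinuousLinearMap (𝕜 := ℝ) (E := E) (F' := ℝ)).finrank_eq]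
    exact (Subspace.dual_finrank_eq (K := ℝ) (V := E)).symm
  refine ⟨(LinearEquiv.ofInjectiveOfFinrankEq _ hinj hdim).toContinuousLinearEquiv, ?_⟩
  ext a : 1
  rfl

variable [IsContMDiffRiemannianBundle 𝓘(ℝ, E) ∞ E (fun (x : M) ↦ TangentSpace 𝓘(ℝ, E) x)]

omit [FiniteDimensional ℝ E] in
theorem contMDiffAt_inner_field {V W : Π y : M, TangentSpace 𝓘(ℝ, E) y} {x : M}
    (hV : ContMDiffAt 𝓘(ℝ, E) 𝓘(ℝ, E).tangent ∞ (T% V) x)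
    (hW : ContMDiffAt 𝓘(ℝ, E) 𝓘(ℝ, E).tangent ∞ (T% W) x) :
    ContMDiffAt 𝓘(ℝ, E) 𝓘(ℝ, ℝ) ∞ (fun y ↦ inner ℝ (V y) (W y)) x :=
  ContMDiffAt.inner_bundle (IB := 𝓘(ℝ, E)) (F := E) (E := fun x : M ↦ TangentSpace 𝓘(ℝ, E) x)
    (b := id) hV hW

theorem contMDiffAt_gramForm {p x : M} (hx : x ∈ (chartAt E p).source) :
    ContMDiffAt 𝓘(ℝ, E) 𝓘(ℝ, E →L[ℝ] E →L[ℝ] ℝ) ∞ (gramForm (E := E) p) x := by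
  unfold gramForm
  refine ContMDiffAt.sum fun i _ ↦ ContMDiffAt.sum fun j _ ↦ ?_
  exact (contMDiffAt_inner_field (contMDiffAt_coordField hx _)
    (contMDiffAt_coordField hx _)).smul contMDiffAt_const

/-- A vector field is smooth if its inner products with the coordinate fields are. -/
theorem contMDiffAt_of_inner {p x : M} (hx : x ∈ (chartAt E p).source)
    {W : Π y : M, TangentSpace 𝓘(ℝ, E) y}
    (hW : ∀ a : E, ContMDiffAt 𝓘(ℝ, E) 𝓘(ℝ, ℝ) ∞
      (fun y ↦ inner ℝ (W y) (coordField p a y)) x) :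
    ContMDiffAt 𝓘(ℝ, E) 𝓘(ℝ, E).tangent ∞ (T% W) x := by
  rw [show ((∞ : ℕ∞ω)) = ((⊤ : ℕ∞) : ℕ∞ω) from rfl, contMDiffAt_iff_tangentCoord hx]
  let ℓ : M → E →L[ℝ] ℝ := fun y ↦ ∑ i, (inner ℝ (W y) (coordField p (Module.finBasis ℝ E i) y)) •
    ((Module.finBasis ℝ E).coord i).toContinuousLinearMap
  have hℓ : ContMDiffAt 𝓘(ℝ, E) 𝓘(ℝ, E →L[ℝ] ℝ) ∞ ℓ x :=
    ContMDiffAt.sum fun i _ ↦ (hW _).smul contMDiffAt_const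
  obtain ⟨e, he⟩ := exists_equiv_gramForm hx
  -- The coordinates of `W` are G⁻¹ ℓ, with G the Gram form and ℓ the functional c ↦ g(W, c).
  -- Inversion of operators is smooth at invertible ones.
  have hinv : ContMDiffAt 𝓘(ℝ, E) 𝓘(ℝ, (E →L[ℝ] ℝ) →L[ℝ] E) ∞
      (fun y ↦ ContinuousLinearMap.inverse (gramForm (E := E) p y)) x := by
    have : CompleteSpace E := FiniteDimensional.complete ℝ E
    have h1 : ContDiffAt ℝ ∞ ContinuousLinearMap.inverse (gramForm (E := E) p x) := by
      rw [← he]; exact contDiffAt_map_inverse e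
    exact h1.contMDiffAt.comp x (contMDiffAt_gramForm hx)
  refine (hinv.clm_apply hℓ).congr_of_eventuallyEq ?_
  filter_upwards [(chartAt E p).open_source.mem_nhds hx] with y hy
  obtain ⟨e', he'⟩ := exists_equiv_gramForm hy
  have h2 : ℓ y = gramForm p y (tangentCoord p y (W y)) := by
    ext c
    rw [gramForm_apply hy, coordField_tangentCoord hy]
    conv_rhs => rw [← sum_coord_smul_finBasis c, coordField_sum_smul _ hy]
    simp [ℓ, inner_sum, real_inner_smul_right, mul_comm]
  rw [h2, ← he', ContinuousLinearMap.inverse_equiv]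
  simp

/-- The Levi-Civita connection is defined pointwise by Riesz representation, so its smoothness has
to be read off from the six terms of this formula. -/
theorem contMDiffOn_koszul {U : Set M} (hU : IsOpen U) {X Y Z : Π y : M, TangentSpace 𝓘(ℝ, E) y}
    (hX : ContMDiffOn 𝓘(ℝ, E) 𝓘(ℝ, E).tangent ∞ (T% X) U)
    (hY : ContMDiffOn 𝓘(ℝ, E) 𝓘(ℝ, E).tangent ∞ (T% Y) U)
    (hZ : ContMDiffOn 𝓘(ℝ, E) 𝓘(ℝ, E).tangent ∞ (T% Z) U) :
    ContMDiffOn 𝓘(ℝ, E) 𝓘(ℝ, ℝ) ∞ (koszul 𝓘(ℝ, E) Y X Z) U := by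
  have hin : ∀ {V W : Π y : M, TangentSpace 𝓘(ℝ, E) y},
      ContMDiffOn 𝓘(ℝ, E) 𝓘(ℝ, E).tangent ∞ (T% V) U →
      ContMDiffOn 𝓘(ℝ, E) 𝓘(ℝ, E).tangent ∞ (T% W) U →
      ContMDiffOn 𝓘(ℝ, E) 𝓘(ℝ, ℝ) ∞ (fun y ↦ inner ℝ (V y) (W y)) U := fun hV hW y hy ↦
    (contMDiffAt_inner_field (hV.contMDiffAt (hU.mem_nhds hy))
      (hW.contMDiffAt (hU.mem_nhds hy))).contMDiffWithinAt
  have hbr : ∀ {V W : Π y : M, TangentSpace 𝓘(ℝ, E) y},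
      ContMDiffOn 𝓘(ℝ, E) 𝓘(ℝ, E).tangent ∞ (T% V) U →
      ContMDiffOn 𝓘(ℝ, E) 𝓘(ℝ, E).tangent ∞ (T% W) U →
      ContMDiffOn 𝓘(ℝ, E) 𝓘(ℝ, E).tangent ∞ (T% (mlieBracket 𝓘(ℝ, E) V W)) U :=
    fun hV hW y hy ↦ (contMDiffAt_mlieBracket (hV.contMDiffAt (hU.mem_nhds hy))
      (hW.contMDiffAt (hU.mem_nhds hy))).contMDiffWithinAt
  unfold koszul
  refine contMDiffOn_const.mul ?_
  exact ((((((contMDiffOn_mvfderiv_apply hU (hin hY hZ) hX).add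
    (contMDiffOn_mvfderiv_apply hU (hin hZ hX) hY)).sub
    (contMDiffOn_mvfderiv_apply hU (hin hX hY) hZ)).add
    (hin (hbr hX hY) hZ)).sub (hin (hbr hX hZ) hY)).sub (hin (hbr hY hZ) hX))

end Smoothness

/-! ### Smooth connections and their Christoffel symbols -/

section ChristoffelSmooth

variable {E : Type*} [NormedAddCommGroup E] [NormedSpace ℝ E] [FiniteDimensional ℝ E]
  {M : Type*} [TopologicalSpace M] [ChartedSpace E M] [IsManifold 𝓘(ℝ, E) ∞ M]

/-- A connection is smooth if the covariant derivatives of coordinate fields are smooth. -/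
def IsSmoothConnection (cov : CovariantDerivative 𝓘(ℝ, E) E (fun x : M ↦ TangentSpace 𝓘(ℝ, E) x)) :
    Prop :=
  ∀ (p : M) (a b : E), ContMDiffOn 𝓘(ℝ, E) 𝓘(ℝ, E).tangent ∞
    (T% (fun y ↦ cov (coordField p b) y (coordField p a y))) (chartAt E p).source

variable {cov : CovariantDerivative 𝓘(ℝ, E) E (fun x : M ↦ TangentSpace 𝓘(ℝ, E) x)}

/-- The coefficients are quadratic in `a` and the vectors depend only on `y`: this separation yields
joint smoothness and evenness in `a`. -/
theorem christoffelQuad_eq_sum {p y : M} (hy : y ∈ (chartAt E p).source) (a : E) :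
    christoffelQuad cov p y a = ∑ i, ∑ j,
      ((Module.finBasis ℝ E).coord i a * (Module.finBasis ℝ E).coord j a) •
        tangentCoord p y (cov (coordField p (Module.finBasis ℝ E i)) y
          (coordField p (Module.finBasis ℝ E j) y)) := by
  have h : coordField p a y = ∑ j, (Module.finBasis ℝ E).coord j a •
      coordField p (Module.finBasis ℝ E j) y := by
    conv_lhs => rw [← (Module.finBasis ℝ E).sum_repr a, coordField_sum_smul _ hy]
    rfl
  rw [christoffelQuad, cov_coordField_const cov hy, tangentCoord_eq_continuousLinearMapAt hy,
    map_sum]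
  refine Finset.sum_congr rfl fun i _ ↦ ?_
  rw [map_smul, h, map_sum, map_sum, Finset.smul_sum]
  refine Finset.sum_congr rfl fun j _ ↦ ?_
  rw [map_smul, map_smul, ← tangentCoord_eq_continuousLinearMapAt hy, smul_smul]

theorem christoffelQuad_neg {p y : M} (hy : y ∈ (chartAt E p).source) (a : E) :
    christoffelQuad cov p y (-a) = christoffelQuad cov p y a := by
  simp [christoffelQuad_eq_sum hy]

theorem contDiffOn_christoffelQuad (hcov : IsSmoothConnection cov) (p : M) :
    ContDiffOn ℝ ∞
      (fun z : E × E ↦ christoffelQuad cov p ((extChartAt 𝓘(ℝ, E) p).symm z.1) z.2)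
      ((extChartAt 𝓘(ℝ, E) p).target ×ˢ univ) := by
  have h1 : ∀ i j, ContDiffOn ℝ ∞ (fun ξ : E ↦ tangentCoord p ((extChartAt 𝓘(ℝ, E) p).symm ξ)
      (cov (coordField p (Module.finBasis ℝ E i)) ((extChartAt 𝓘(ℝ, E) p).symm ξ)
        (coordField p (Module.finBasis ℝ E j) ((extChartAt 𝓘(ℝ, E) p).symm ξ))))
      (extChartAt 𝓘(ℝ, E) p).target := by
    intro i j
    have h2 : ContMDiffOn 𝓘(ℝ, E) 𝓘(ℝ, E) ∞ (fun y ↦ tangentCoord p y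
        (cov (coordField p (Module.finBasis ℝ E i)) y (coordField p (Module.finBasis ℝ E j) y)))
        (chartAt E p).source := fun y hy ↦
      ((contMDiffAt_iff_tangentCoord (n := ⊤) hy).1
        ((hcov p _ _).contMDiffAt ((chartAt E p).open_source.mem_nhds hy))).contMDiffWithinAt
    have h3 := h2.comp (contMDiffOn_extChartAt_symm (I := 𝓘(ℝ, E)) p)
      (fun ξ hξ ↦ by simpa using (extChartAt 𝓘(ℝ, E) p).map_target hξ)
    exact contMDiffOn_iff_contDiffOn.1 h3
  have h4 : ContDiffOn ℝ ∞ (fun z : E × E ↦ ∑ i, ∑ j,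
      ((Module.finBasis ℝ E).coord i z.2 * (Module.finBasis ℝ E).coord j z.2) •
        tangentCoord p ((extChartAt 𝓘(ℝ, E) p).symm z.1)
          (cov (coordField p (Module.finBasis ℝ E i)) ((extChartAt 𝓘(ℝ, E) p).symm z.1)
            (coordField p (Module.finBasis ℝ E j) ((extChartAt 𝓘(ℝ, E) p).symm z.1))))
      ((extChartAt 𝓘(ℝ, E) p).target ×ˢ univ) := by
    have hc : ∀ i, ContDiff ℝ ∞ (fun z : E × E ↦ (Module.finBasis ℝ E).coord i z.2) := fun i ↦
      ((Module.finBasis ℝ E).coord i).toContinuousLinearMap.contDiff.comp contDiff_snd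
    refine ContDiffOn.sum fun i _ ↦ ContDiffOn.sum fun j _ ↦ ?_
    exact ((hc i).mul (hc j)).contDiffOn.smul
      ((h1 i j).comp contDiff_fst.contDiffOn (fun z hz ↦ hz.1))
  refine h4.congr fun z hz ↦ ?_
  exact christoffelQuad_eq_sum (by simpa using (extChartAt 𝓘(ℝ, E) p).map_target hz.1) z.2

variable [RiemannianBundle (fun (x : M) ↦ TangentSpace 𝓘(ℝ, E) x)]
  [IsContMDiffRiemannianBundle 𝓘(ℝ, E) ∞ E (fun (x : M) ↦ TangentSpace 𝓘(ℝ, E) x)]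

/-- Smoothness of `K` is not a hypothesis but follows from `hK`: tested against a coordinate field,
both summands are explicit smooth functions, and `contMDiffAt_of_inner` recovers the vector field.
-/
theorem isSmoothConnection_addDifferenceTensor {σ : M → ℝ}
    (hσ : ContMDiff 𝓘(ℝ, E) 𝓘(ℝ, ℝ) ∞ σ) {α₁ α₂ α₃ : ℝ}
    {K : Π x : M, TangentSpace 𝓘(ℝ, E) x →L[ℝ] TangentSpace 𝓘(ℝ, E) x →L[ℝ]
      TangentSpace 𝓘(ℝ, E) x}
    (hK : ∀ (x : M) (X Y Z : TangentSpace 𝓘(ℝ, E) x),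
      inner ℝ (K x X Y) Z = cubicForm 𝓘(ℝ, E) σ α₁ α₂ α₃ x X Y Z) :
    IsSmoothConnection (addDifferenceTensor (leviCivita 𝓘(ℝ, E) M) K) := by
  intro p a b x hx
  have hU := (chartAt E p).open_source
  have hf : ∀ c : E, ContMDiffOn 𝓘(ℝ, E) 𝓘(ℝ, E).tangent ∞ (T% (coordField p c))
      (chartAt E p).source := fun c y hy ↦
    (contMDiffAt_coordField (n := ⊤) hy c).contMDiffWithinAt
  refine (contMDiffAt_of_inner hx fun c ↦ ?_).contMDiffWithinAt
  have hin : ∀ c d : E, ContMDiffOn 𝓘(ℝ, E) 𝓘(ℝ, ℝ) ∞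
      (fun y ↦ inner ℝ (coordField p c y) (coordField p d y)) (chartAt E p).source :=
    fun c d y hy ↦ (contMDiffAt_inner_field (contMDiffAt_coordField (n := ⊤) hy c)
      (contMDiffAt_coordField (n := ⊤) hy d)).contMDiffWithinAt
  have hdσ : ∀ c : E, ContMDiffOn 𝓘(ℝ, E) 𝓘(ℝ, ℝ) ∞
      (fun y ↦ mvfderiv 𝓘(ℝ, E) σ y (coordField p c y)) (chartAt E p).source :=
    fun c ↦ contMDiffOn_mvfderiv_apply hU hσ.contMDiffOn (hf c)
  have h : ContMDiffOn 𝓘(ℝ, E) 𝓘(ℝ, ℝ) ∞ (fun y ↦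
      koszul 𝓘(ℝ, E) (coordField p b) (coordField p a) (coordField p c) y +
        (α₁ * inner ℝ (coordField p a y) (coordField p b y) *
            mvfderiv 𝓘(ℝ, E) σ y (coordField p c y)
          + α₂ * inner ℝ (coordField p b y) (coordField p c y) *
            mvfderiv 𝓘(ℝ, E) σ y (coordField p a y)
          + α₃ * inner ℝ (coordField p a y) (coordField p c y) *
            mvfderiv 𝓘(ℝ, E) σ y (coordField p b y))) (chartAt E p).source :=
    (contMDiffOn_koszul hU (hf a) (hf b) (hf c)).add
      ((((contMDiffOn_const.mul (hin a b)).mul (hdσ c)).add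
        ((contMDiffOn_const.mul (hin b c)).mul (hdσ a))).add
        ((contMDiffOn_const.mul (hin a c)).mul (hdσ b)))
  refine (h.contMDiffAt (hU.mem_nhds hx)).congr_of_eventuallyEq ?_
  filter_upwards [hU.mem_nhds hx] with y hy
  rw [addDifferenceTensor_apply, inner_add_left, hK,
    inner_leviCivita 𝓘(ℝ, E) (mdifferentiableAt_coordField hy b) (mdifferentiableAt_coordField hy a)
      (mdifferentiableAt_coordField hy c)]
  rfl

end ChristoffelSmooth

/-! ### The conserved quantity and the speed bound -/

section Energy

variable {E : Type*} [NormedAddCommGroup E] [NormedSpace ℝ E] [FiniteDimensional ℝ E]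
  {M : Type*} [TopologicalSpace M] [ChartedSpace E M] [IsManifold 𝓘(ℝ, E) ∞ M]
  [RiemannianBundle (fun (x : M) ↦ TangentSpace 𝓘(ℝ, E) x)]
  [IsContMDiffRiemannianBundle 𝓘(ℝ, E) ∞ E (fun (x : M) ↦ TangentSpace 𝓘(ℝ, E) x)]

-- The two connections differ by a tensor, which sees the extension of `V t` only through its value
-- at `γ t`.
omit [FiniteDimensional ℝ E]
  [IsContMDiffRiemannianBundle 𝓘(ℝ, E) ∞ E (fun (x : M) ↦ TangentSpace 𝓘(ℝ, E) x)] in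
theorem covDerivAlong_addDifferenceTensor
    (cov : CovariantDerivative 𝓘(ℝ, E) E (fun x : M ↦ TangentSpace 𝓘(ℝ, E) x))
    (K : Π x : M, TangentSpace 𝓘(ℝ, E) x →L[ℝ] TangentSpace 𝓘(ℝ, E) x →L[ℝ]
      TangentSpace 𝓘(ℝ, E) x) (γ : ℝ → M) (V : Π s : ℝ, TangentSpace 𝓘(ℝ, E) (γ s)) (t : ℝ) :
    covDerivAlong (addDifferenceTensor cov K) γ V t =
      covDerivAlong cov γ V t + K (γ t) (curveVelocity 𝓘(ℝ, E) γ t) (V t) := by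
  have h : addDifferenceTensor cov K (extend E (V t)) (γ t) (curveVelocity 𝓘(ℝ, E) γ t) =
      cov (extend E (V t)) (γ t) (curveVelocity 𝓘(ℝ, E) γ t) +
        K (γ t) (curveVelocity 𝓘(ℝ, E) γ t) (extend E (V t) (γ t)) := rfl
  simp only [covDerivAlong, h, extend_apply_self, add_assoc]

/-- Metric compatibility of the Levi-Civita connection along a curve. -/
theorem hasDerivAt_inner_curveVelocity {γ : ℝ → M} {t : ℝ}
    (hγ : ContMDiffAt 𝓘(ℝ, ℝ) 𝓘(ℝ, E) ∞ γ t) :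
    HasDerivAt (fun s ↦ inner ℝ (curveVelocity 𝓘(ℝ, E) γ s) (curveVelocity 𝓘(ℝ, E) γ s))
      (2 * inner ℝ (covDerivAlong (leviCivita 𝓘(ℝ, E) M) γ (curveVelocity 𝓘(ℝ, E) γ) t)
        (curveVelocity 𝓘(ℝ, E) γ t)) t := by
  obtain ⟨p, hp⟩ : ∃ p : M, γ t ∈ (chartAt E p).source := ⟨γ t, mem_chart_source E (γ t)⟩
  have hd : MDiffAt γ t := hγ.mdifferentiableAt (by simp)
  have hsrc : ∀ᶠ s in 𝓝 t, γ s ∈ (chartAt E p).source :=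
    hγ.continuousAt ((chartAt E p).open_source.mem_nhds hp)
  have hw : DifferentiableAt ℝ
      (fun s ↦ tangentCoord p (γ s) (curveVelocity 𝓘(ℝ, E) γ s)) t :=
    differentiableAt_tangentCoord_curveVelocity hγ hp
  set w : ℝ → E := fun s ↦ tangentCoord p (γ s) (curveVelocity 𝓘(ℝ, E) γ s) with hwdef
  have hG := (contMDiffAt_gramForm hp).mdifferentiableAt (by simp)
  have h1 : HasDerivAt (fun s ↦ gramForm (E := E) p (γ s))
      (mvfderiv 𝓘(ℝ, E) (gramForm (E := E) p) (γ t) (curveVelocity 𝓘(ℝ, E) γ t)) t :=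
    hasDerivAt_comp_curve hd hG
  have h2 := (h1.clm_apply hw.hasDerivAt).clm_apply hw.hasDerivAt
  have hev : (fun s ↦ inner ℝ (curveVelocity 𝓘(ℝ, E) γ s) (curveVelocity 𝓘(ℝ, E) γ s)) =ᶠ[𝓝 t]
      fun s ↦ gramForm (E := E) p (γ s) (w s) (w s) := by
    filter_upwards [hsrc] with s hs
    rw [gramForm_apply hs, hwdef, coordField_tangentCoord hs]
  refine (h2.congr_of_eventuallyEq hev).congr_deriv ?_
  set X := curveVelocity 𝓘(ℝ, E) γ t with hX
  have hwX : coordField p (w t) (γ t) = X := coordField_tangentCoord hp X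
  -- Metric compatibility is applied to the coordinate field with coefficients frozen at `w t`. The
  -- terms with the derivative of `w` come from the product rule `h2`.
  have h3 : mvfderiv 𝓘(ℝ, E) (gramForm (E := E) p) (γ t) X (w t) (w t) =
      2 * inner ℝ (leviCivita 𝓘(ℝ, E) M (coordField p (w t)) (γ t) X) X := by
    have hf := mdifferentiableAt_coordField hp (w t)
    have h4 := leviCivita_metric 𝓘(ℝ, E) (mdifferentiableAt_extend 𝓘(ℝ, E) E X) hf hf
    rw [extend_apply_self, hwX, real_inner_comm, ← two_mul] at h4
    rw [real_inner_comm, ← h4]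
    rw [← mvfderiv_clm_apply hG, ← mvfderiv_clm_apply (mdifferentiableAt_clm_apply hG _)]
    have hev2 : (fun z ↦ gramForm (E := E) p z (w t) (w t)) =ᶠ[𝓝 (γ t)]
        fun z ↦ inner ℝ (coordField p (w t) z) (coordField p (w t) z) := by
      filter_upwards [(chartAt E p).open_source.mem_nhds hp] with z hz
      exact gramForm_apply hz _ _
    exact congrArg (fun L ↦ L X) (hev2.mfderiv_eq (I := 𝓘(ℝ, E)) (I' := 𝓘(ℝ, ℝ)))
  rw [covDerivAlong_eq _ hd hp hw, inner_add_left]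
  change (mvfderiv 𝓘(ℝ, E) (gramForm (E := E) p) (γ t) X (w t) +
    gramForm (E := E) p (γ t) (deriv w t)) (w t) + gramForm (E := E) p (γ t) (w t) (deriv w t) =
    2 * (inner ℝ (coordField p (deriv w t) (γ t)) X +
      inner ℝ (leviCivita 𝓘(ℝ, E) M (coordField p (w t)) (γ t) X) X)
  rw [add_apply, h3, gramForm_apply hp, gramForm_apply hp, hwX,
    real_inner_comm (coordField p (deriv w t) (γ t)) X]
  ring

/-- Along a geodesic of the perturbed connection the quantity `|γ'|² e^{2ασ}` is conserved, so the
speed is bounded when `σ` is bounded below. -/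
theorem exists_norm_curveVelocity_le {σ : M → ℝ}
    (hσ : ContMDiff 𝓘(ℝ, E) 𝓘(ℝ, ℝ) ∞ σ) (hσ_bdd : BddBelow (range σ))
    {α₁ α₂ α₃ : ℝ} (hα : 0 ≤ α₁ + α₂ + α₃)
    {K : Π x : M, TangentSpace 𝓘(ℝ, E) x →L[ℝ] TangentSpace 𝓘(ℝ, E) x →L[ℝ]
      TangentSpace 𝓘(ℝ, E) x}
    (hK : ∀ (x : M) (X Y Z : TangentSpace 𝓘(ℝ, E) x),
      inner ℝ (K x X Y) Z = cubicForm 𝓘(ℝ, E) σ α₁ α₂ α₃ x X Y Z)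
    {J : Set ℝ} (hJ : IsOpen J) (hJc : J.OrdConnected) {γ : ℝ → M}
    (hγ : IsGeodesicOn (addDifferenceTensor (leviCivita 𝓘(ℝ, E) M) K) γ J) :
    ∃ C : ℝ, ∀ t ∈ J, ‖curveVelocity 𝓘(ℝ, E) γ t‖ ≤ C := by
  obtain rfl | ⟨t₀, ht₀⟩ := J.eq_empty_or_nonempty
  · exact ⟨0, by simp⟩
  obtain ⟨m, hm⟩ := hσ_bdd
  set α := α₁ + α₂ + α₃ with hαdef
  set f : ℝ → ℝ := fun s ↦ inner ℝ (curveVelocity 𝓘(ℝ, E) γ s) (curveVelocity 𝓘(ℝ, E) γ s) *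
    Real.exp (2 * α * σ (γ s)) with hf
  have hderiv : ∀ t ∈ J, HasDerivAt f 0 t := by
    intro t ht
    have hγt := hγ.contMDiffOn.contMDiffAt (hJ.mem_nhds ht)
    have h1 := hasDerivAt_inner_curveVelocity hγt
    have h2 : HasDerivAt (fun s ↦ σ (γ s))
        (mvfderiv 𝓘(ℝ, E) σ (γ t) (curveVelocity 𝓘(ℝ, E) γ t)) t :=
      hasDerivAt_comp_curve (hγt.mdifferentiableAt (by simp))
        (hσ.contMDiffAt.mdifferentiableAt (by simp))
    have h3 := hγ.covDerivAlong_eq_zero t ht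
    rw [covDerivAlong_addDifferenceTensor, add_eq_zero_iff_eq_neg] at h3
    -- With all three arguments equal to γ', the cubic form collapses to α |γ'|² dσ(γ'), which
    -- cancels the derivative of the exponential factor.
    refine (h1.mul (h2.const_mul (2 * α)).exp).congr_deriv ?_
    rw [h3, inner_neg_left, hK, cubicForm, hαdef]
    ring
  have hconst : ∀ t ∈ J, f t = f t₀ := fun t ht ↦
    hJ.is_const_of_deriv_eq_zero (isPreconnected_iff_ordConnected.2 hJc)
      (fun s hs ↦ (hderiv s hs).differentiableAt.differentiableWithinAt)
      (fun s hs ↦ (hderiv s hs).deriv) ht ht₀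
  -- From σ ≥ m and α ≥ 0: |γ'|² e^{2αm} ≤ |γ'|² e^{2ασ} = `f t₀`.
  refine ⟨Real.sqrt (f t₀ / Real.exp (2 * α * m)), fun t ht ↦ ?_⟩
  apply Real.le_sqrt_of_sq_le
  rw [le_div_iff₀ (Real.exp_pos _), ← hconst t ht, hf, ← real_inner_self_eq_norm_sq]
  refine mul_le_mul_of_nonneg_left (Real.exp_le_exp.2 ?_) real_inner_self_nonneg
  exact mul_le_mul_of_nonneg_left (hm (mem_range_self _)) (by positivity)

end Energy

/-! ### Regularity and continuation for autonomous equations -/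

section ODE

variable {F : Type*} [NormedAddCommGroup F] [NormedSpace ℝ F]

/-- Solutions of a smooth autonomous ordinary differential equation are smooth. -/
theorem contDiffOn_of_hasDerivAt_autonomous {f : F → F} {U : Set F} (hf : ContDiffOn ℝ ∞ f U)
    {S : Set ℝ} (hS : IsOpen S) {z : ℝ → F} (hzU : ∀ t ∈ S, z t ∈ U)
    (hz : ∀ t ∈ S, HasDerivAt z (f (z t)) t) : ContDiffOn ℝ ∞ z S := by
  rw [contDiffOn_infty]
  intro n
  -- Bootstrapping: if z is Cⁿ then z' = f ∘ z is Cⁿ, so z is Cⁿ⁺¹.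
  induction n with
  | zero =>
    exact contDiffOn_zero.2 fun t ht ↦ (hz t ht).continuousAt.continuousWithinAt
  | succ n ih =>
    rw [Nat.cast_succ, contDiffOn_succ_iff_deriv_of_isOpen hS]
    refine ⟨fun t ht ↦ (hz t ht).differentiableAt.differentiableWithinAt, by simp, ?_⟩
    exact ((hf.of_le (by exact_mod_cast le_top)).comp ih hzU).congr fun t ht ↦ (hz t ht).deriv

/-- A solution of an autonomous equation with a limit inside the domain extends past the end of its
interval. -/
theorem exists_extension_of_tendsto [CompleteSpace F] {f : F → F} {U : Set F} (hU : IsOpen U)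
    (hf : ContDiffOn ℝ ∞ f U) {a b : ℝ} (hab : a < b) {z : ℝ → F}
    (hzU : ∀ t ∈ Ioo a b, z t ∈ U) (hz : ∀ t ∈ Ioo a b, HasDerivAt z (f (z t)) t) {z₀ : F}
    (hz₀ : z₀ ∈ U) (hlim : Tendsto z (𝓝[<] b) (𝓝 z₀)) :
    ∃ ε > 0, ∃ y : ℝ → F, EqOn y z (Iio b) ∧
      ∀ t ∈ Ioo a (b + ε), y t ∈ U ∧ HasDerivAt y (f (y t)) t := by
  -- The extension is `z` before time `b` and afterwards the local solution `w` with `w b = z₀`.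
  have hf₀ : ContDiffAt ℝ ∞ f z₀ := hf.contDiffAt (hU.mem_nhds hz₀)
  obtain ⟨w, hwb, δ, hδ, hw⟩ :=
    (hf₀.of_le (m := 1) (by exact_mod_cast le_top)
      ).exists_forall_mem_closedBall_exists_eq_forall_mem_Ioo_hasDerivAt₀ b
  have hbδ : b ∈ Ioo (b - δ) (b + δ) := ⟨by linarith, by linarith⟩
  have hwU : ∀ᶠ t in 𝓝 b, w t ∈ U :=
    (hw b hbδ).continuousAt (hU.mem_nhds (by rwa [hwb]))
  obtain ⟨ε₁, hε₁, hwU⟩ := Metric.eventually_nhds_iff.1 hwU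
  set y : ℝ → F := fun t ↦ if t < b then z t else w t with hy
  have hyz : ∀ t, t < b → y t = z t := fun t ht ↦ if_pos ht
  have hyw : ∀ t, b ≤ t → y t = w t := fun t ht ↦ if_neg ht.not_gt
  -- `δ` is the existence time of `w`, and `ε₁` keeps `w` inside `U`.
  refine ⟨min δ ε₁, lt_min hδ hε₁, y, fun t ht ↦ hyz t ht, fun t ht ↦ ?_⟩
  obtain h | rfl | h := lt_trichotomy t b
  · have hev : y =ᶠ[𝓝 t] z := by
      filter_upwards [Iio_mem_nhds h] with s hs using hyz s hs
    rw [hyz t h]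
    exact ⟨hzU t ⟨ht.1, h⟩, (hz t ⟨ht.1, h⟩).congr_of_eventuallyEq hev⟩
  · have hyt : y t = z₀ := by rw [hyw t le_rfl, hwb]
    rw [hyt]
    refine ⟨hz₀, ?_⟩
    have hright : HasDerivWithinAt y (f z₀) (Ici t) t := by
      have := (hw t hbδ).hasDerivWithinAt (s := Ici t)
      rw [hwb] at this
      exact this.congr (fun s hs ↦ hyw s hs) (hyw t le_rfl)
    have hevl : ∀ᶠ s in 𝓝[<] t, s ∈ Ioo a t := Ioo_mem_nhdsLT hab
    have hdz : ∀ s ∈ Ioo a t, HasDerivAt y (f (z s)) s := fun s hs ↦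
      (hz s hs).congr_of_eventuallyEq (by
        filter_upwards [Iio_mem_nhds hs.2] with r hr using hyz r hr)
    -- At the junction the left derivative exists because y is continuous there and its derivative
    -- f(z) tends to f(z₀).
    have hleft : HasDerivWithinAt y (f z₀) (Iic t) t := by
      apply hasDerivWithinAt_Iic_of_tendsto_deriv (s := Ioo a t)
      · exact fun s hs ↦ (hdz s hs).differentiableAt.differentiableWithinAt
      · rw [ContinuousWithinAt, hyt]
        refine (hlim.mono_left (nhdsWithin_mono _ Ioo_subset_Iio_self)).congr' ?_
        filter_upwards [self_mem_nhdsWithin] with s hs using (hyz s hs.2).symm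
      · exact hevl
      · refine (hf₀.continuousAt.tendsto.comp hlim).congr' ?_
        filter_upwards [hevl] with s hs using (hdz s hs).deriv.symm
    have := hleft.union hright
    rwa [Iic_union_Ici, hasDerivWithinAt_univ] at this
  · have hev : y =ᶠ[𝓝 t] w := by
      filter_upwards [Ioi_mem_nhds h] with s hs using hyw s (le_of_lt hs)
    rw [hyw t h.le]
    have h1 := ht.2.trans_le (add_le_add_right (min_le_left δ ε₁) b)
    have h2 := ht.2.trans_le (add_le_add_right (min_le_right δ ε₁) b)
    refine ⟨hwU ?_, (hw t ⟨by linarith, h1⟩).congr_of_eventuallyEq hev⟩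
    rw [Real.dist_eq, abs_of_pos] <;> linarith

/-- A function that is Lipschitz on a set has a limit along any filter on this set that converges
in the domain. -/
theorem exists_tendsto_of_lipschitzOnWith {X Y : Type*} [PseudoEMetricSpace X]
    [PseudoEMetricSpace Y] [CompleteSpace Y] {C : NNReal} {f : X → Y} {s : Set X}
    (hf : LipschitzOnWith C f s) {l : Filter X} [l.NeBot] {x : X} (hl : l ≤ 𝓝 x) (hs : s ∈ l) :
    ∃ y, Tendsto f l (𝓝 y) := by
  have h1 : Cauchy l := cauchy_nhds.mono hl
  have h2 : Cauchy (map f l) := by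
    refine ⟨inferInstance, ?_⟩
    rw [prod_map_map_eq]
    exact hf.uniformContinuousOn.mono_left
      (le_inf h1.2 (le_principal_iff.2 (prod_mem_prod hs hs)))
  exact CompleteSpace.complete h2

end ODE

/-! ### Geodesics as solutions of a first order system -/

section ChartGeodesics

variable {E : Type*} [NormedAddCommGroup E] [NormedSpace ℝ E] [FiniteDimensional ℝ E]
  {M : Type*} [TopologicalSpace M] [ChartedSpace E M] [IsManifold 𝓘(ℝ, E) ∞ M]
  {cov : CovariantDerivative 𝓘(ℝ, E) E (fun x : M ↦ TangentSpace 𝓘(ℝ, E) x)}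

variable (cov) in
/-- The first order system equivalent to the geodesic equation in the chart at `p`. -/
noncomputable def geodesicField (p : M) (z : E × E) : E × E :=
  (z.2, -christoffelQuad cov p ((extChartAt 𝓘(ℝ, E) p).symm z.1) z.2)

theorem contDiffOn_geodesicField (hcov : IsSmoothConnection cov) (p : M) :
    ContDiffOn ℝ ∞ (geodesicField cov p) ((extChartAt 𝓘(ℝ, E) p).target ×ˢ univ) :=
  contDiffOn_snd.prodMk (contDiffOn_christoffelQuad hcov p).neg

/-- Being a geodesic is a local property. -/
theorem isGeodesicOn_of_forall_eventuallyEq {γ : ℝ → M} {J : Set ℝ}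
    (h : ∀ t ∈ J, ∃ (γ' : ℝ → M) (J' : Set ℝ), IsOpen J' ∧ t ∈ J' ∧ IsGeodesicOn cov γ' J' ∧
      γ =ᶠ[𝓝 t] γ') : IsGeodesicOn cov γ J := by
  have hsm : ∀ t ∈ J, ContMDiffAt 𝓘(ℝ, ℝ) 𝓘(ℝ, E) ∞ γ t := fun t ht ↦ by
    obtain ⟨γ', J', hJ', htJ', hγ', hev⟩ := h t ht
    exact (hγ'.contMDiffOn.contMDiffAt (hJ'.mem_nhds htJ')).congr_of_eventuallyEq hev
  refine ⟨fun t ht ↦ (hsm t ht).contMDiffWithinAt, fun t ht ↦ ?_⟩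
  obtain ⟨γ', J', hJ', htJ', hγ', hev⟩ := h t ht
  have hp : γ t ∈ (chartAt E (γ t)).source := mem_chart_source E (γ t)
  have h1 := hγ'.covDerivAlong_eq_zero t htJ'
  -- The accelerations of the two curves have different dependent types. In one common chart the
  -- equations are `E`-valued and depend only on the germs of the curves.
  rw [covDerivAlong_curveVelocity_eq_zero_iff cov
    (hγ'.contMDiffOn.contMDiffAt (hJ'.mem_nhds htJ')) (p := γ t) (by rwa [← hev.eq_of_nhds])] at h1
  rw [covDerivAlong_curveVelocity_eq_zero_iff cov (hsm t ht) hp]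
  have h2 : (fun s ↦ extChartAt 𝓘(ℝ, E) (γ t) (γ s)) =ᶠ[𝓝 t]
      fun s ↦ extChartAt 𝓘(ℝ, E) (γ t) (γ' s) := hev.fun_comp _
  rw [h2.deriv.deriv_eq, h2.deriv_eq]
  convert h1 using 3
  exact hev.eq_of_nhds

theorem IsGeodesicOn.congr {γ γ' : ℝ → M} {J : Set ℝ} (hJ : IsOpen J) (hγ : IsGeodesicOn cov γ J)
    (h : EqOn γ' γ J) : IsGeodesicOn cov γ' J :=
  isGeodesicOn_of_forall_eventuallyEq fun _ ht ↦
    ⟨γ, J, hJ, ht, hγ, h.eventuallyEq_of_mem (hJ.mem_nhds ht)⟩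

theorem IsGeodesicOn.union {γ : ℝ → M} {J J' : Set ℝ} (hJ : IsOpen J) (hJ' : IsOpen J')
    (h : IsGeodesicOn cov γ J) (h' : IsGeodesicOn cov γ J') : IsGeodesicOn cov γ (J ∪ J') :=
  isGeodesicOn_of_forall_eventuallyEq fun _ ht ↦ ht.elim
    (fun ht ↦ ⟨γ, J, hJ, ht, h, .rfl⟩) (fun ht ↦ ⟨γ, J', hJ', ht, h', .rfl⟩)

/-- In a chart a geodesic and its velocity solve the first order system. -/
theorem IsGeodesicOn.hasDerivAt_chart {γ : ℝ → M} {J : Set ℝ} (hJ : IsOpen J)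
    (hγ : IsGeodesicOn cov γ J) {p : M} {t : ℝ} (ht : t ∈ J)
    (hp : γ t ∈ (chartAt E p).source) :
    HasDerivAt (fun s ↦ (extChartAt 𝓘(ℝ, E) p (γ s),
        deriv (fun r ↦ extChartAt 𝓘(ℝ, E) p (γ r)) s))
      (geodesicField cov p (extChartAt 𝓘(ℝ, E) p (γ t),
        deriv (fun r ↦ extChartAt 𝓘(ℝ, E) p (γ r)) t)) t := by
  have hγt := hγ.contMDiffOn.contMDiffAt (hJ.mem_nhds ht)
  have h1 := (covDerivAlong_curveVelocity_eq_zero_iff cov hγt hp).1 (hγ.covDerivAlong_eq_zero t ht)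
  have hx : ContDiffAt ℝ ∞ (fun s ↦ extChartAt 𝓘(ℝ, E) p (γ s)) t :=
    ((contMDiffAt_extChartAt' (by simpa using hp)).comp t hγt).contDiffAt
  have h2 : DifferentiableAt ℝ (deriv (fun s ↦ extChartAt 𝓘(ℝ, E) p (γ s))) t :=
    (differentiableAt_tangentCoord_curveVelocity hγt hp).congr_of_eventuallyEq
      (tangentCoord_curveVelocity_eventuallyEq hγt hp).symm
  refine ((hx.differentiableAt (by simp)).hasDerivAt.prodMk h2.hasDerivAt).congr_deriv ?_
  rw [geodesicField, (extChartAt 𝓘(ℝ, E) p).left_inv (by simpa using hp),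
    ← eq_neg_of_add_eq_zero_left h1]

/-- A solution of the first order system projects to a geodesic. -/
theorem isGeodesicOn_of_hasDerivAt (hcov : IsSmoothConnection cov) {p : M} {z : ℝ → E × E}
    {S : Set ℝ} (hS : IsOpen S) (hzU : ∀ t ∈ S, (z t).1 ∈ (extChartAt 𝓘(ℝ, E) p).target)
    (hz : ∀ t ∈ S, HasDerivAt z (geodesicField cov p (z t)) t) :
    IsGeodesicOn cov (fun t ↦ (extChartAt 𝓘(ℝ, E) p).symm (z t).1) S := by
  have hsm : ContDiffOn ℝ ∞ z S :=
    contDiffOn_of_hasDerivAt_autonomous (contDiffOn_geodesicField hcov p) hS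
      (fun t ht ↦ ⟨hzU t ht, mem_univ _⟩) hz
  have hγ : ContMDiffOn 𝓘(ℝ, ℝ) 𝓘(ℝ, E) ∞ (fun t ↦ (extChartAt 𝓘(ℝ, E) p).symm (z t).1) S :=
    (contMDiffOn_extChartAt_symm p).comp
      (contDiff_fst.comp_contDiffOn hsm).contMDiffOn (fun t ht ↦ hzU t ht)
  refine ⟨hγ, fun t ht ↦ ?_⟩
  have hp : (extChartAt 𝓘(ℝ, E) p).symm (z t).1 ∈ (chartAt E p).source := by
    simpa using (extChartAt 𝓘(ℝ, E) p).map_target (hzU t ht)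
  rw [covDerivAlong_curveVelocity_eq_zero_iff cov (hγ.contMDiffAt (hS.mem_nhds ht)) hp]
  have h1 : ∀ s ∈ S, (fun r ↦ extChartAt 𝓘(ℝ, E) p ((extChartAt 𝓘(ℝ, E) p).symm (z r).1))
      =ᶠ[𝓝 s] fun r ↦ (z r).1 := fun s hs ↦ by
    filter_upwards [hS.mem_nhds hs] with r hr
    exact (extChartAt 𝓘(ℝ, E) p).right_inv (hzU r hr)
  -- The first component of the system identifies the coordinate velocity with `(z s).2`; the second
  -- is then the geodesic equation.
  have h2 : ∀ s ∈ S, deriv (fun r ↦ extChartAt 𝓘(ℝ, E) p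
      ((extChartAt 𝓘(ℝ, E) p).symm (z r).1)) s = (z s).2 := fun s hs ↦ by
    rw [(h1 s hs).deriv_eq]
    exact ((ContinuousLinearMap.fst ℝ E E).hasFDerivAt.comp_hasDerivAt s (hz s hs)).deriv
  have h3 : deriv (fun r ↦ extChartAt 𝓘(ℝ, E) p ((extChartAt 𝓘(ℝ, E) p).symm (z r).1))
      =ᶠ[𝓝 t] fun r ↦ (z r).2 := by
    filter_upwards [hS.mem_nhds ht] with s hs using h2 s hs
  have h4 : deriv (fun r ↦ (z r).2) t = (geodesicField cov p (z t)).2 :=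
    ((ContinuousLinearMap.snd ℝ E E).hasFDerivAt.comp_hasDerivAt t (hz t ht)).deriv
  rw [h3.deriv_eq, h2 t ht, h4, geodesicField]
  simp

/-- Time reversal of geodesics. -/
theorem IsGeodesicOn.comp_neg {γ : ℝ → M} {J : Set ℝ} (hJ : IsOpen J)
    (hγ : IsGeodesicOn cov γ J) : IsGeodesicOn cov (fun t ↦ γ (-t)) (-J) := by
  have hsm : ContMDiffOn 𝓘(ℝ, ℝ) 𝓘(ℝ, E) ∞ (fun t ↦ γ (-t)) (-J) :=
    hγ.contMDiffOn.comp contDiff_neg.contDiffOn.contMDiffOn (fun t ht ↦ ht)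
  refine ⟨hsm, fun t ht ↦ ?_⟩
  have hp : γ (-t) ∈ (chartAt E (γ (-t))).source := mem_chart_source E _
  have h1 := (covDerivAlong_curveVelocity_eq_zero_iff cov
    (hγ.contMDiffOn.contMDiffAt (hJ.mem_nhds ht)) hp).1 (hγ.covDerivAlong_eq_zero _ ht)
  rw [covDerivAlong_curveVelocity_eq_zero_iff cov (hsm.contMDiffAt (hJ.neg.mem_nhds ht)) hp]
  have h2 : deriv (fun s ↦ extChartAt 𝓘(ℝ, E) (γ (-t)) (γ (-s))) =
      fun s ↦ -deriv (fun s ↦ extChartAt 𝓘(ℝ, E) (γ (-t)) (γ s)) (-s) := by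
    ext s
    exact deriv_comp_neg (fun s ↦ extChartAt 𝓘(ℝ, E) (γ (-t)) (γ s)) s
  -- The second derivative is unchanged by time reversal, and so is the Christoffel term, being even
  -- in the velocity.
  rw [h2, deriv.fun_neg, deriv_comp_neg, neg_neg, christoffelQuad_neg hp]
  exact h1

end ChartGeodesics

/-! ### Extension of geodesics of bounded speed, and completeness -/

section Extension

variable {E : Type*} [NormedAddCommGroup E] [NormedSpace ℝ E] [FiniteDimensional ℝ E]
  {M : Type*} [EMetricSpace M] [ChartedSpace E M] [IsManifold 𝓘(ℝ, E) ∞ M]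
  [RiemannianBundle (fun (x : M) ↦ TangentSpace 𝓘(ℝ, E) x)]
  {cov : CovariantDerivative 𝓘(ℝ, E) E (fun x : M ↦ TangentSpace 𝓘(ℝ, E) x)}

omit [FiniteDimensional ℝ E] [IsManifold 𝓘(ℝ, E) ∞ M] in
/-- A curve of bounded speed is Lipschitz. -/
theorem lipschitzOnWith_of_norm_curveVelocity_le [IsRiemannianManifold 𝓘(ℝ, E) M] {γ : ℝ → M}
    {J : Set ℝ} (hJc : J.OrdConnected) (hγ : ContMDiffOn 𝓘(ℝ, ℝ) 𝓘(ℝ, E) 1 γ J) {C : NNReal}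
    (hC : ∀ t ∈ J, ‖curveVelocity 𝓘(ℝ, E) γ t‖ ≤ C) : LipschitzOnWith C γ J := by
  have key : ∀ s ∈ J, ∀ t ∈ J, s ≤ t → edist (γ s) (γ t) ≤ C * edist s t := by
    intro s hs t ht hst
    rw [IsRiemannianManifold.out (I := 𝓘(ℝ, E)) (γ s) (γ t)]
    refine (Manifold.riemannianEDist_le_pathELength (hγ.mono (hJc.out hs ht)) rfl rfl hst).trans ?_
    rw [Manifold.pathELength_eq_lintegral_mfderiv_Ioo]
    calc ∫⁻ r in Ioo s t, ‖mfderiv 𝓘(ℝ, ℝ) 𝓘(ℝ, E) γ r 1‖ₑ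
        ≤ ∫⁻ _ in Ioo s t, (C : ENNReal) := by
          refine MeasureTheory.setLIntegral_mono' measurableSet_Ioo fun r hr ↦ ?_
          have h := hC r (hJc.out hs ht (Ioo_subset_Icc_self hr))
          change ‖curveVelocity 𝓘(ℝ, E) γ r‖ₑ ≤ C
          rw [← ofReal_norm, ← ENNReal.ofReal_coe_nnreal]
          exact ENNReal.ofReal_le_ofReal h
      _ = C * edist s t := by
          rw [MeasureTheory.setLIntegral_const, Real.volume_Ioo, edist_comm, edist_dist,
            Real.dist_eq, abs_of_nonneg (by linarith)]
  intro s hs t ht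
  obtain h | h := le_total s t
  · exact key s hs t ht h
  · rw [edist_comm, edist_comm s]
    exact key t ht s hs h

variable [IsContMDiffRiemannianBundle 𝓘(ℝ, E) ∞ E (fun (x : M) ↦ TangentSpace 𝓘(ℝ, E) x)]

/-- A geodesic of bounded speed that converges in `M` at the end of its interval has a limit
velocity in the chart at the limit point, and the chart coordinates stay in the chart. -/
theorem exists_tendsto_chart (hcov : IsSmoothConnection cov) {J : Set ℝ} (hJ : IsOpen J)
    {γ : ℝ → M} (hγ : IsGeodesicOn cov γ J) {C : NNReal}
    (hC : ∀ t ∈ J, ‖curveVelocity 𝓘(ℝ, E) γ t‖ ≤ C) {a b : ℝ} (hab : a < b)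
    (hJab : Ioo a b ⊆ J) {p : M} (hp : Tendsto γ (𝓝[<] b) (𝓝 p)) :
    ∃ a' ∈ Ico a b, (∀ t ∈ Ioo a' b, γ t ∈ (chartAt E p).source) ∧ ∃ v₀ : E,
      Tendsto (fun s ↦ (extChartAt 𝓘(ℝ, E) p (γ s),
        deriv (fun r ↦ extChartAt 𝓘(ℝ, E) p (γ r)) s)) (𝓝[<] b)
        (𝓝 (extChartAt 𝓘(ℝ, E) p p, v₀)) := by
  have hxlim : Tendsto (fun s ↦ extChartAt 𝓘(ℝ, E) p (γ s)) (𝓝[<] b)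
      (𝓝 (extChartAt 𝓘(ℝ, E) p p)) := (continuousAt_extChartAt p).tendsto.comp hp
  -- A compact ball inside the chart target, on which the geodesic field can be bounded.
  obtain ⟨r, hr, hrT⟩ := Metric.nhds_basis_closedBall.mem_iff.1
    (extChartAt_target_mem_nhds (I := 𝓘(ℝ, E)) p)
  have : IsContinuousRiemannianBundle E (fun x : M ↦ TangentSpace 𝓘(ℝ, E) x) := by
    obtain ⟨g, hg, hin⟩ := IsContMDiffRiemannianBundle.exists_contMDiff (IB := 𝓘(ℝ, E)) (n := ∞)
      (F := E) (E := fun x : M ↦ TangentSpace 𝓘(ℝ, E) x)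
    exact ⟨⟨g, hg.continuous, hin⟩⟩
  -- Near `p` the trivialization has operator norm below `C'`, so a bound on Riemannian speed bounds
  -- the coordinate velocity.
  obtain ⟨C', hC', hev⟩ := eventually_norm_trivializationAt_lt E
    (fun x : M ↦ TangentSpace 𝓘(ℝ, E) x) p
  have hev1 : ∀ᶠ t in 𝓝[<] b, γ t ∈ (chartAt E p).source :=
    hp ((chartAt E p).open_source.mem_nhds (mem_chart_source E p))
  have hev2 := hp.eventually hev
  have hev3 := hxlim.eventually (Metric.closedBall_mem_nhds _ hr)
  obtain ⟨a', ha', hsub⟩ := (mem_nhdsLT_iff_exists_mem_Ico_Ioo_subset hab).1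
    ((hev1.and (hev2.and hev3)))
  refine ⟨a', ha', fun t ht ↦ (hsub ht).1, ?_⟩
  set x : ℝ → E := fun r ↦ extChartAt 𝓘(ℝ, E) p (γ r) with hx
  have hinJ : ∀ t ∈ Ioo a' b, t ∈ J := fun t ht ↦ hJab ⟨ha'.1.trans_lt ht.1, ht.2⟩
  have hode : ∀ t ∈ Ioo a' b, HasDerivAt (fun s ↦ (x s, deriv x s))
      (geodesicField cov p (x t, deriv x t)) t := fun t ht ↦
    hγ.hasDerivAt_chart hJ (hinJ t ht) (hsub ht).1
  have hvel : ∀ t ∈ Ioo a' b, ‖deriv x t‖ ≤ C' * C := by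
    intro t ht
    have hd : MDiffAt γ t :=
      (hγ.contMDiffOn.contMDiffAt (hJ.mem_nhds (hinJ t ht))).mdifferentiableAt (by simp)
    rw [hx, ← tangentCoord_curveVelocity hd (hsub ht).1,
      tangentCoord_eq_continuousLinearMapAt (hsub ht).1]
    refine (ContinuousLinearMap.le_opNorm _ _).trans ?_
    exact mul_le_mul (hsub ht).2.1.le (hC t (hinJ t ht)) (norm_nonneg _) hC'.le
  -- Positions and velocities remain in a compact product. There the field is bounded by `B`, which
  -- makes position and velocity Lipschitz in time up to `b`.
  obtain ⟨B, hB⟩ := ((isCompact_closedBall (extChartAt 𝓘(ℝ, E) p p) r).prod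
    (isCompact_closedBall (0 : E) (C' * C))).exists_bound_of_continuousOn
      (f := geodesicField cov p)
      ((contDiffOn_geodesicField hcov p).continuousOn.mono
        (prod_mono hrT (subset_univ _)))
  have hlip : LipschitzOnWith B.toNNReal (fun s ↦ (x s, deriv x s)) (Ioo a' b) := by
    refine (convex_Ioo a' b).lipschitzOnWith_of_nnnorm_hasDerivWithin_le
      (fun t ht ↦ (hode t ht).hasDerivWithinAt) fun t ht ↦ ?_
    rw [← NNReal.coe_le_coe, coe_nnnorm]
    refine (hB (x t, deriv x t) ⟨(hsub ht).2.2, ?_⟩).trans (Real.le_coe_toNNReal B)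
    simpa using hvel t ht
  obtain ⟨⟨y, v₀⟩, hlim⟩ := exists_tendsto_of_lipschitzOnWith hlip (l := 𝓝[<] b)
    nhdsWithin_le_nhds (Ioo_mem_nhdsLT ha'.2)
  refine ⟨v₀, ?_⟩
  have hy : y = extChartAt 𝓘(ℝ, E) p p :=
    tendsto_nhds_unique ((continuous_fst.tendsto _).comp hlim) hxlim
  rwa [hy] at hlim

variable [IsRiemannianManifold 𝓘(ℝ, E) M] [CompleteSpace M]

/-- A geodesic of bounded speed in a complete manifold extends past the right end. -/
theorem exists_extension_sSup (hcov : IsSmoothConnection cov) {J : Set ℝ} (hJ : IsOpen J)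
    (hJc : J.OrdConnected) (hJn : J.Nonempty) (hJb : BddAbove J)
    {γ : ℝ → M} (hγ : IsGeodesicOn cov γ J) {C : ℝ}
    (hC : ∀ t ∈ J, ‖curveVelocity 𝓘(ℝ, E) γ t‖ ≤ C) :
    ∃ (J' : Set ℝ) (γ' : ℝ → M), IsOpen J' ∧ J'.OrdConnected ∧ J ⊆ J' ∧ sSup J ∈ J' ∧
      IsGeodesicOn cov γ' J' ∧ EqOn γ' γ J := by
  obtain ⟨a, haJ⟩ := hJn
  have hlub := isLUB_csSup ⟨a, haJ⟩ hJb
  set b := sSup J with hb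
  -- An open set does not contain its supremum.
  have hltb : ∀ t ∈ J, t < b := by
    intro t ht
    obtain ⟨ε, hε, hball⟩ := Metric.isOpen_iff.1 hJ t ht
    have h1 : t + ε / 2 ∈ J := hball (by
      rw [Metric.mem_ball, Real.dist_eq, add_sub_cancel_left, abs_of_pos] <;> linarith)
    linarith [hlub.1 h1]
  have hab := hltb a haJ
  have hJab : Ioo a b ⊆ J := by
    intro t ht
    obtain ⟨c, hc, htc⟩ := hlub.exists_between ht.2
    exact hJc.out haJ hc ⟨ht.1.le, htc.1.le⟩
  have hC' : ∀ t ∈ J, ‖curveVelocity 𝓘(ℝ, E) γ t‖ ≤ C.toNNReal := fun t ht ↦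
    (hC t ht).trans (Real.le_coe_toNNReal C)
  obtain ⟨p, hp⟩ := exists_tendsto_of_lipschitzOnWith
    (lipschitzOnWith_of_norm_curveVelocity_le hJc
      (hγ.contMDiffOn.of_le (by exact_mod_cast le_top)) hC') (l := 𝓝[<] b)
    nhdsWithin_le_nhds (mem_of_superset (Ioo_mem_nhdsLT hab) hJab)
  obtain ⟨a', ha', hsrc, v₀, hlim⟩ := exists_tendsto_chart hcov hJ hγ hC' hab hJab hp
  have hinJ : Ioo a' b ⊆ J := (Ioo_subset_Ioo_left ha'.1).trans hJab
  obtain ⟨ε, hε, z, hzeq, hz⟩ := exists_extension_of_tendsto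
    ((isOpen_extChartAt_target p).prod isOpen_univ) (contDiffOn_geodesicField hcov p) ha'.2
    (fun t ht ↦ ⟨(extChartAt 𝓘(ℝ, E) p).map_source (by simpa using hsrc t ht), mem_univ _⟩)
    (fun t ht ↦ hγ.hasDerivAt_chart hJ (hinJ ht) (hsrc t ht))
    ⟨mem_extChartAt_target p, mem_univ v₀⟩ hlim
  set η : ℝ → M := fun t ↦ (extChartAt 𝓘(ℝ, E) p).symm (z t).1 with hη
  have hgeo : IsGeodesicOn cov η (Ioo a' (b + ε)) :=
    isGeodesicOn_of_hasDerivAt hcov isOpen_Ioo (fun t ht ↦ (hz t ht).1.1) (fun t ht ↦ (hz t ht).2)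
  have hηγ : ∀ t ∈ Ioo a' b, η t = γ t := by
    intro t ht
    rw [hη]
    beta_reduce
    rw [hzeq ht.2]
    exact (extChartAt 𝓘(ℝ, E) p).left_inv (by simpa using hsrc t ht)
  -- `γ` and `η` agree on `Ioo a' b`, so the glued curve coincides with `γ` on all of `J` and with
  -- `η` on its whole interval.
  set γ' : ℝ → M := fun t ↦ if t < b then γ t else η t with hγ'
  have h1 : EqOn γ' γ J := fun t ht ↦ if_pos (hltb t ht)
  have h2 : EqOn γ' η (Ioo a' (b + ε)) := fun t ht ↦ by
    by_cases h : t < b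
    · rw [hγ']; simp [h, hηγ t ⟨ht.1, h⟩]
    · rw [hγ']; simp [h]
  obtain ⟨c, hc⟩ : (Ioo a' b).Nonempty := nonempty_Ioo.2 ha'.2
  refine ⟨J ∪ Ioo a' (b + ε), γ', hJ.union isOpen_Ioo, ?_, subset_union_left,
    Or.inr ⟨ha'.2, by linarith⟩, (hγ.congr hJ h1).union hJ isOpen_Ioo (hgeo.congr isOpen_Ioo h2),
    h1⟩
  refine IsPreconnected.ordConnected ?_
  exact IsPreconnected.union c (hinJ hc) ⟨hc.1, hc.2.trans (by linarith)⟩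
    (isPreconnected_iff_ordConnected.2 hJc) isPreconnected_Ioo

/-- A geodesic of bounded speed in a complete manifold extends past the left end. -/
theorem exists_extension_sInf (hcov : IsSmoothConnection cov) {J : Set ℝ} (hJ : IsOpen J)
    (hJc : J.OrdConnected) (hJn : J.Nonempty) (hJb : BddBelow J)
    {γ : ℝ → M} (hγ : IsGeodesicOn cov γ J) {C : ℝ}
    (hC : ∀ t ∈ J, ‖curveVelocity 𝓘(ℝ, E) γ t‖ ≤ C) :
    ∃ (J' : Set ℝ) (γ' : ℝ → M), IsOpen J' ∧ J'.OrdConnected ∧ J ⊆ J' ∧ sInf J ∈ J' ∧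
      IsGeodesicOn cov γ' J' ∧ EqOn γ' γ J := by
  have hneg : ∀ {S : Set ℝ}, S.OrdConnected → (-S).OrdConnected := by
    intro S hS
    refine ⟨fun s hs t ht r hr ↦ ?_⟩
    exact hS.out (mem_neg.1 ht) (mem_neg.1 hs) ⟨neg_le_neg hr.2, neg_le_neg hr.1⟩
  -- The reversed geodesic obeys the same speed bound, which reduces the left end to the right end.
  have hvel : ∀ t ∈ -J, ‖curveVelocity 𝓘(ℝ, E) (fun s ↦ γ (-s)) t‖ ≤ C := by
    intro t ht
    have hd : MDiffAt γ (-t) :=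
      (hγ.contMDiffOn.contMDiffAt (hJ.mem_nhds ht)).mdifferentiableAt (by simp)
    have h1 := mfderiv_comp t hd (differentiableAt_id.neg.mdifferentiableAt (x := t))
    have h2 : curveVelocity 𝓘(ℝ, E) (fun s ↦ γ (-s)) t =
        -curveVelocity 𝓘(ℝ, E) γ (-t) := by
      have h3 := congrArg (fun L ↦ L (1 : ℝ)) h1
      rw [mfderiv_eq_fderiv] at h3
      refine h3.trans ?_
      change mfderiv 𝓘(ℝ, ℝ) 𝓘(ℝ, E) γ (-t) (fderiv ℝ (fun s : ℝ ↦ -s) t 1) = _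
      rw [fderiv_fun_neg, fderiv_fun_id]
      exact map_neg _ _
    rw [h2]
    exact (norm_neg _).trans_le (hC _ ht)
  obtain ⟨J', γ', hJ', hJc', hsub, hmem, hgeo, heq⟩ := exists_extension_sSup hcov hJ.neg (hneg hJc)
    hJn.neg hJb.neg (hγ.comp_neg hJ) hvel
  refine ⟨-J', fun t ↦ γ' (-t), hJ'.neg, hneg hJc', fun t ht ↦ hsub (by simpa using ht), ?_,
    hgeo.comp_neg hJ', fun t ht ↦ ?_⟩
  · rwa [Real.sSup_neg] at hmem
  · have := heq (show -t ∈ -J by simpa using ht)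
    simpa using this

/-- A smooth connection on a complete Riemannian manifold is complete if its geodesics have bounded
speed. -/
theorem isCompleteConnection_of_norm_curveVelocity_le (hcov : IsSmoothConnection cov)
    (hspeed : ∀ (J : Set ℝ) (γ : ℝ → M), IsOpen J → J.OrdConnected → IsGeodesicOn cov γ J →
      ∃ C : ℝ, ∀ t ∈ J, ‖curveVelocity 𝓘(ℝ, E) γ t‖ ≤ C) : IsCompleteConnection cov := by
  intro J₀ γ₀ hJ₀ hJc₀ hJn₀ hγ₀
  let P : Set ℝ × (ℝ → M) → Prop := fun q ↦
    IsOpen q.1 ∧ q.1.OrdConnected ∧ J₀ ⊆ q.1 ∧ IsGeodesicOn cov q.2 q.1 ∧ EqOn q.2 γ₀ J₀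
  -- Values off the interval are arbitrary, so this is only a preorder; the form of Zorn's lemma
  -- used needs transitivity alone.
  let r : {q // P q} → {q // P q} → Prop := fun q q' ↦
    q.1.1 ⊆ q'.1.1 ∧ EqOn q'.1.2 q.1.2 q.1.1
  obtain ⟨⟨⟨J, γ⟩, hJ, hJc, hJsub, hγ, hγeq⟩, hmax⟩ :=
    exists_maximal_of_chains_bounded (r := r) (by
      intro c hc
      obtain rfl | hcn := c.eq_empty_or_nonempty
      · exact ⟨⟨(J₀, γ₀), hJ₀, hJc₀, Subset.rfl, hγ₀, fun _ _ ↦ rfl⟩, by simp⟩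
      classical
      have htot : ∀ q ∈ c, ∀ q' ∈ c, r q q' ∨ r q' q := by
        intro q hq q' hq'
        by_cases h : q = q'
        · exact Or.inl (h ▸ ⟨Subset.rfl, fun _ _ ↦ rfl⟩)
        · exact hc hq hq' h
      -- The union of the chain: any member defined at `t` may be chosen, since members of a chain
      -- agree where both are defined. The value `γ₀ t` elsewhere is irrelevant.
      set γ : ℝ → M := fun t ↦ if h : ∃ q ∈ c, t ∈ q.1.1 then h.choose.1.2 t else γ₀ t with hγ
      have hγq : ∀ q ∈ c, EqOn γ q.1.2 q.1.1 := by
        intro q hq t ht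
        have h : ∃ q ∈ c, t ∈ q.1.1 := ⟨q, hq, ht⟩
        have h1 : γ t = h.choose.1.2 t := dif_pos h
        rw [h1]
        obtain h2 | h2 := htot _ h.choose_spec.1 q hq
        · exact (h2.2 h.choose_spec.2).symm
        · exact h2.2 ht
      obtain ⟨q₀, hq₀⟩ := hcn
      have hdir : (⋃ q ∈ c, q.1.1).OrdConnected := by
        refine ⟨fun s hs t ht ↦ ?_⟩
        simp only [mem_iUnion, exists_prop] at hs ht
        obtain ⟨q, hq, hsq⟩ := hs
        obtain ⟨q', hq', htq'⟩ := ht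
        obtain h | h := htot q hq q' hq'
        · exact (q'.2.2.1.out (h.1 hsq) htq').trans (subset_biUnion_of_mem (u := fun q ↦ q.1.1) hq')
        · exact (q.2.2.1.out hsq (h.1 htq')).trans (subset_biUnion_of_mem (u := fun q ↦ q.1.1) hq)
      refine ⟨⟨(⋃ q ∈ c, q.1.1, γ), isOpen_biUnion fun q _ ↦ q.2.1, hdir,
        q₀.2.2.2.1.trans (subset_biUnion_of_mem (u := fun q ↦ q.1.1) hq₀), ?_, ?_⟩, fun q hq ↦
        ⟨subset_biUnion_of_mem (u := fun q ↦ q.1.1) hq, hγq q hq⟩⟩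
      · refine isGeodesicOn_of_forall_eventuallyEq fun t ht ↦ ?_
        simp only [mem_iUnion, exists_prop] at ht
        obtain ⟨q, hq, htq⟩ := ht
        exact ⟨q.1.2, q.1.1, q.2.1, htq, q.2.2.2.2.1,
          (hγq q hq).eventuallyEq_of_mem (q.2.1.mem_nhds htq)⟩
      · intro t ht
        exact (hγq q₀ hq₀ (q₀.2.2.2.1 ht)).trans (q₀.2.2.2.2.2 ht))
    (fun {q q' q''} h h' ↦ ⟨h.1.trans h'.1, fun t ht ↦ (h'.2 (h.1 ht)).trans (h.2 ht)⟩)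
  have hext : ∀ (J' : Set ℝ) (γ' : ℝ → M), IsOpen J' → J'.OrdConnected → J ⊆ J' →
      IsGeodesicOn cov γ' J' → EqOn γ' γ J → J' ⊆ J := fun J' γ' h1 h2 h3 h4 h5 ↦
    (hmax ⟨(J', γ'), h1, h2, hJsub.trans h3, h4,
      fun t ht ↦ (h5 (hJsub ht)).trans (hγeq ht)⟩ ⟨h3, h5⟩).1
  have hJn : J.Nonempty := hJn₀.mono hJsub
  obtain ⟨C, hC⟩ := hspeed J γ hJ hJc hγ
  -- Otherwise an extension reaches `sSup J`; by maximality `sSup J ∈ J`, which is impossible for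
  -- open `J`.
  have habove : ¬ BddAbove J := by
    intro hb
    obtain ⟨J', γ', h1, h2, h3, h4, h5, h6⟩ := exists_extension_sSup hcov hJ hJc hJn hb hγ hC
    have hmem := hext J' γ' h1 h2 h3 h5 h6 h4
    obtain ⟨ε, hε, hball⟩ := Metric.isOpen_iff.1 hJ _ hmem
    have h7 : sSup J + ε / 2 ∈ J := hball (by
      rw [Metric.mem_ball, Real.dist_eq, add_sub_cancel_left, abs_of_pos] <;> linarith)
    linarith [le_csSup hb h7]
  have hbelow : ¬ BddBelow J := by
    intro hb
    obtain ⟨J', γ', h1, h2, h3, h4, h5, h6⟩ := exists_extension_sInf hcov hJ hJc hJn hb hγ hC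
    have hmem := hext J' γ' h1 h2 h3 h5 h6 h4
    obtain ⟨ε, hε, hball⟩ := Metric.isOpen_iff.1 hJ _ hmem
    have h7 : sInf J - ε / 2 ∈ J := hball (by
      rw [Metric.mem_ball, Real.dist_eq, sub_sub_cancel_left, abs_neg, abs_of_pos] <;> linarith)
    linarith [csInf_le hb h7]
  have huniv : J = univ := by
    refine eq_univ_of_forall fun t ↦ ?_
    obtain ⟨s, hs, hst⟩ := not_bddBelow_iff.1 hbelow t
    obtain ⟨u, hu, htu⟩ := not_bddAbove_iff.1 habove t
    exact hJc.out hs hu ⟨hst.le, htu.le⟩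
  exact ⟨γ, huniv ▸ hγ, hγeq⟩

end Extension

theorem theorem4p4
    {E : Type*} [NormedAddCommGroup E] [NormedSpace ℝ E] [FiniteDimensional ℝ E]
    {M : Type*} [EMetricSpace M] [ChartedSpace E M] [IsManifold 𝓘(ℝ, E) ∞ M]
    [RiemannianBundle (fun (x : M) ↦ TangentSpace 𝓘(ℝ, E) x)]
    [IsContMDiffRiemannianBundle 𝓘(ℝ, E) ∞ E (fun (x : M) ↦ TangentSpace 𝓘(ℝ, E) x)]
    [IsRiemannianManifold 𝓘(ℝ, E) M] [CompleteSpace M]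
    (σ : M → ℝ) (hσ : ContMDiff 𝓘(ℝ, E) 𝓘(ℝ, ℝ) ∞ σ) (hσ_bdd : BddBelow (Set.range σ))
    (α₁ α₂ α₃ : ℝ) (hα : 0 ≤ α₁ + α₂ + α₃)
    (K : Π x : M, TangentSpace 𝓘(ℝ, E) x →L[ℝ] TangentSpace 𝓘(ℝ, E) x →L[ℝ]
      TangentSpace 𝓘(ℝ, E) x)
    (hK : ∀ (x : M) (X Y Z : TangentSpace 𝓘(ℝ, E) x),
      inner ℝ (K x X Y) Z = cubicForm 𝓘(ℝ, E) σ α₁ α₂ α₃ x X Y Z) :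
    IsCompleteConnection (addDifferenceTensor (leviCivita 𝓘(ℝ, E) M) K) := by
  exact isCompleteConnection_of_norm_curveVelocity_le
    (isSmoothConnection_addDifferenceTensor hσ hK) fun J γ hJ hJc hγ ↦
      exists_norm_curveVelocity_le hσ hσ_bdd hα hK hJ hJc hγ
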